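/- Fix a prime $p$. Conventions: "countable" means at most countable; a group is locally finite if all of its finitely generated subgroups are finite; a $p$-group is a group all of whose elements have $p$-power order; a Sylow $p$-subgroup of a (possibly infinite) group $G$ is a $p$-subgroup of $G$ that contains every $p$-subgroup of $G$ up to conjugacy in $G$, and $\mathrm{Syl}_p(G)$ is the set of these. A discrete $p$-toral group is a group with a normal subgroup of $p$-power index that is isomorphic to $(\mathbb{Z}/p^\infty)^r$ for some $r\ge 0$; for such a group $P$, with identity component $U$ (the intersection of its subgroups of finite index, $U\cong(\mathbb{Z}/p^\infty)^r$), its order is $|P|=(r,|P/U|)\in\mathbb{N}^2$, ordered lexicographically. A fusion system $\mathcal{F}$ over a discrete $p$-toral group $S$ is a category whose objects are the subgroups of $S$, with $\mathrm{Hom}_S(P,Q)\subseteq\mathrm{Hom}_{\mathcal{F}}(P,Q)\subseteq\mathrm{Inj}(P,Q)$ for all $P,Q\le S$ (where $\mathrm{Hom}_S(P,Q)$ is the set of homomorphisms induced by conjugation in $S$, and $\mathrm{Inj}(P,Q)$ the set of injective homomorphisms), such that $\varphi^{-1}\in\mathrm{Hom}_{\mathcal{F}}(\varphi(P),P)$ for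 each $\varphi\in\mathrm{Hom}_{\mathcal{F}}(P,Q)$. For $P\le S$, let $P^{\mathcal{F}}=\{\varphi(P)\mid\varphi\in\mathrm{Hom}_{\mathcal{F}}(P,S)\}$. The subgroup $P$ is fully normalized (fully centralized) in $\mathcal{F}$ if $|N_S(P)|\ge|N_S(P^*)|$ (respectively $|C_S(P)|\ge|C_S(P^*)|$) for all $P^*\in P^{\mathcal{F}}$; it is fully automized if $\mathrm{Out}_{\mathcal{F}}(P)=\mathrm{Aut}_{\mathcal{F}}(P)/\mathrm{Inn}(P)$ is finite and $\mathrm{Out}_S(P)=\mathrm{Aut}_S(P)/\mathrm{Inn}(P)$ is a Sylow $p$-subgroup of it; it is receptive if each $\varphi\in\mathrm{Hom}_{\mathcal{F}}(Q,P)$ with $Q\in P^{\mathcal{F}}$ extends to a morphism in $\mathrm{Hom}_{\mathcal{F}}(N_\varphi,S)$, where $N_\varphi=\{g\in N_S(Q)\mid \varphi c_g\varphi^{-1}\in\mathrm{Aut}_S(\varphi(Q))\}$. The fusion system $\mathcal{F}$ is saturated if (1) every fully normalized subgroup of $S$ is fully automized and fully centralized; (2) every fully centralized subgroup of $S$ is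 receptive; and (3) for $P\le S$, every injective homomorphism $\varphi\colon P\to S$ such that $\varphi|_R\in\mathrm{Hom}_{\mathcal{F}}(R,S)$ for each finite $R\le P$ lies in $\mathrm{Hom}_{\mathcal{F}}(P,S)$. For a group $G$ and a discrete $p$-toral subgroup $S\le G$, $\mathcal{F}_S(G)$ is the fusion system over $S$ with $\mathrm{Hom}_{\mathcal{F}_S(G)}(P,Q)=\{c_g\mid g\in G,\ gPg^{-1}\le Q\}$, where $c_g(x)=gxg^{-1}$. If $\mathcal{F}_1\le\mathcal{F}_2\le\cdots$ is an increasing sequence of saturated fusion systems over finite subgroups $S_1\le S_2\le\cdots$ of a discrete $p$-toral group $S=\bigcup_i S_i$, then $\bigcup_i\mathcal{F}_i$ is the fusion system over $S$ in which $\mathrm{Hom}(P,Q)$ is the set of homomorphisms $\varphi\colon P\to Q$ such that for each finite $R\le P$ there is $i\ge 1$ with $R\le S_i$ and $\varphi|_R\in\mathrm{Hom}_{\mathcal{F}_i}(R,Q\cap S_i)$. **Proposition.** Let $\mathcal{F}$ be a saturated fusion system over a discrete $p$-toral group $S$. Assume $G$ is a locally finite group containing $S$ such that $\mathcal{F}=\mathcal{F}_S(G)$.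 Then the following hold. (a) There is a countable subgroup $G_*\le G$ such that $S\le G_*$ and $\mathcal{F}=\mathcal{F}_S(G_*)$. (b) If $G$ is countable and $S\in\mathrm{Syl}_p(G)$, then there is an increasing sequence $G_1\le G_2\le\cdots$ of finite subgroups of $G$ such that $S_i:=S\cap G_i\in\mathrm{Syl}_p(G_i)$ for each $i$ and $G=\bigcup_{i\ge 1}G_i$. For each such sequence, (b.1) $S=\bigcup_{i\ge 1}S_i$; and (b.2) the $\mathcal{F}_{S_i}(G_i)$ form an increasing sequence of saturated fusion systems over the finite subgroups $S_i$, and $\mathcal{F}=\bigcup_{i\ge 1}\mathcal{F}_{S_i}(G_i)$ in the sense defined above. -/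

import Mathlib

/-! Fusion systems over discrete `p`-toral groups.

All groups that occur are subgroups of one ambient group `G`; a fusion system over `S ≤ G`
has as objects the subgroups of `S`, i.e. the `P : Subgroup G` with `P ≤ S`. -/

namespace Fusion

/-! ### Locally finite groups, Sylow subgroups, discrete `p`-toral groups -/

/-- Every finitely generated subgroup is finite. -/
def IsLocallyFiniteGroup (G : Type*) [Group G] : Prop :=
  ∀ H : Subgroup G, H.FG → Finite H

/-- A Sylow `p`-subgroup of an arbitrary group `G`: a `p`-subgroup which contains all
`p`-subgroups of `G` up to conjugacy in `G`. -/
def IsSylow (p : ℕ) {G : Type*} [Group G] (T : Subgroup G) : Prop :=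
  IsPGroup p T ∧
    ∀ P : Subgroup G, IsPGroup p P → ∃ g : G, ∀ x ∈ P, g * x * g⁻¹ ∈ T

/-- The group `ℤ/p^∞`, realized as the subgroup of elements of `p`-power order in `ℚ/ℤ`. -/
abbrev Prufer (p : ℕ) [Fact p.Prime] : Type :=
  AddCommGroup.primaryComponent (AddCircle (1 : ℚ)) p

/-- `U ≅ (ℤ/p^∞)^r`. -/
def IsDiscreteTorusOfRank (p : ℕ) [Fact p.Prime] (U : Type*) [Group U] (r : ℕ) : Prop :=
  Nonempty (U ≃* Multiplicative (Fin r → Prufer p))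

/-- A discrete `p`-torus. -/
def IsDiscreteTorus (p : ℕ) [Fact p.Prime] (U : Type*) [Group U] : Prop :=
  ∃ r : ℕ, IsDiscreteTorusOfRank p U r

/-- A discrete `p`-toral group: it has a normal subgroup of `p`-power index that is a
discrete `p`-torus. -/
def IsDiscreteToral (p : ℕ) [Fact p.Prime] (P : Type*) [Group P] : Prop :=
  ∃ U : Subgroup P, U.Normal ∧ IsDiscreteTorus p U ∧ ∃ n : ℕ, U.index = p ^ n

/-- The identity component: the intersection of all subgroups of finite index. -/
def identityComponent (P : Type*) [Group P] : Subgroup P :=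
  ⨅ (U : Subgroup P) (_ : U.FiniteIndex), U

open Classical in
/-- The rank of a discrete `p`-torus (with value `0` on all other groups). -/
noncomputable def torusRank (p : ℕ) [Fact p.Prime] (U : Type*) [Group U] : ℕ :=
  if h : IsDiscreteTorus p U then Nat.find h else 0

/-- The order `|P| = (rk U, |P/U|)` of a discrete `p`-toral group `P` with identity component
`U`, in `ℕ²` with the lexicographic ordering. -/
noncomputable def toralOrder (p : ℕ) [Fact p.Prime] (P : Type*) [Group P] : ℕ ×ₗ ℕ :=
  toLex (torusRank p (identityComponent P), (identityComponent P).index)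

/-! ### Fusion systems -/

section

variable {G : Type*} [Group G]

/-- The homomorphisms `P → Q` that are conjugation `x ↦ g x g⁻¹` by an element `g ∈ H`. -/
def conjHom (H P Q : Subgroup G) : Set (P →* Q) :=
  {φ | ∃ g ∈ H, ∀ x : P, (φ x : G) = g * x * g⁻¹}

/-- The image `φ(P)`, as a subgroup of the ambient group. -/
def image {P Q : Subgroup G} (φ : P →* Q) : Subgroup G :=
  (Q.subtype.comp φ).range

/-- The homomorphism `φ` as a map onto its image. -/
def toImage {P Q : Subgroup G} (φ : P →* Q) : P →* image φ :=
  (Q.subtype.comp φ).rangeRestrict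

lemma toImage_coe {P Q : Subgroup G} (φ : P →* Q) (x : P) : (toImage φ x : G) = φ x := rfl

lemma toImage_surjective {P Q : Subgroup G} (φ : P →* Q) :
    Function.Surjective (toImage φ) :=
  (Q.subtype.comp φ).rangeRestrict_surjective

lemma image_le {P Q : Subgroup G} (φ : P →* Q) : image φ ≤ Q := by
  rintro _ ⟨x, rfl⟩
  exact (φ x).2

end

/-- A fusion system over `S`: a category whose objects are the subgroups of `S`, whose
morphism sets satisfy `Hom_S(P, Q) ⊆ Hom(P, Q) ⊆ Inj(P, Q)`, with composition of
homomorphisms (the identities lie in `Hom_S(P, P)`), and in which the inverse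
`φ⁻¹ : φ(P) → P` of each morphism `φ` is again a morphism. -/
@[ext]
structure FusionSystem {G : Type*} [Group G] (S : Subgroup G) where
  /-- The set of morphisms from `P` to `Q`. -/
  Hom : ∀ P Q : Subgroup G, Set (P →* Q)
  dom_le : ∀ {P Q : Subgroup G} {φ : P →* Q}, φ ∈ Hom P Q → P ≤ S
  cod_le : ∀ {P Q : Subgroup G} {φ : P →* Q}, φ ∈ Hom P Q → Q ≤ S
  inj : ∀ {P Q : Subgroup G} {φ : P →* Q}, φ ∈ Hom P Q → Function.Injective φ
  conj_mem : ∀ {P Q : Subgroup G}, P ≤ S → Q ≤ S → conjHom S P Q ⊆ Hom P Q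
  comp_mem : ∀ {P Q R : Subgroup G} {φ : P →* Q} {ψ : Q →* R},
    φ ∈ Hom P Q → ψ ∈ Hom Q R → ψ.comp φ ∈ Hom P R
  inv_mem : ∀ {P Q : Subgroup G} {φ : P →* Q}, φ ∈ Hom P Q →
    ∀ ψ : image φ →* P, (∀ x : P, ψ (toImage φ x) = x) → ψ ∈ Hom (image φ) P

/-- The fusion system `F_S(H)`: for `P, Q ≤ S`, the morphisms `P → Q` are the conjugations
by elements of `H`. -/
def fusionSystemOf {G : Type*} [Group G] (H S : Subgroup G) (hSH : S ≤ H) :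
    FusionSystem S where
  Hom P Q := {φ | P ≤ S ∧ Q ≤ S ∧ φ ∈ conjHom H P Q}
  dom_le h := h.1
  cod_le h := h.2.1
  inj := by
    rintro P Q φ ⟨-, -, g, -, hg⟩ x y hxy
    have h : g * (x : G) * g⁻¹ = g * y * g⁻¹ := by rw [← hg, ← hg, hxy]
    exact Subtype.ext (by simpa using h)
  conj_mem := by
    rintro P Q hP hQ φ ⟨g, hg, h⟩
    exact ⟨hP, hQ, g, hSH hg, h⟩
  comp_mem := by
    rintro P Q R φ ψ ⟨hP, -, g, hg, h⟩ ⟨-, hR, g', hg', h'⟩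
    refine ⟨hP, hR, g' * g, H.mul_mem hg' hg, fun x => ?_⟩
    rw [MonoidHom.comp_apply, h', h]
    group
  inv_mem := by
    rintro P Q φ ⟨hP, hQ, g, hg, h⟩ ψ hψ
    refine ⟨(image_le φ).trans hQ, hP, g⁻¹, H.inv_mem hg, fun y => ?_⟩
    obtain ⟨x, rfl⟩ := toImage_surjective φ y
    rw [hψ, toImage_coe, h]
    group

namespace FusionSystem

variable {G : Type*} [Group G] {S : Subgroup G}

lemma id_mem (F : FusionSystem S) {P : Subgroup G} (hP : P ≤ S) :
    MonoidHom.id P ∈ F.Hom P P :=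
  F.conj_mem hP hP ⟨1, S.one_mem, fun x => by simp⟩

/-- The `F`-conjugacy class `P^F = {φ(P) | φ ∈ Hom_F(P, S)}`. -/
def conjClass (F : FusionSystem S) (P : Subgroup G) : Set (Subgroup G) :=
  {R | ∃ φ ∈ F.Hom P S, R = image φ}

/-- `Aut_F(P)`, as a group of automorphisms of `P`. -/
def aut (F : FusionSystem S) (P : Subgroup G) (hP : P ≤ S) : Subgroup (MulAut P) where
  carrier := {α | (α : P ≃* P).toMonoidHom ∈ F.Hom P P}
  one_mem' := F.id_mem hP
  mul_mem' := fun {_ _} ha hb => F.comp_mem hb ha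
  inv_mem' := by
    intro α hα
    have him : image (α : P ≃* P).toMonoidHom = P := by
      apply le_antisymm (image_le _)
      intro x hx
      exact ⟨(α : P ≃* P).symm ⟨x, hx⟩, by simp⟩
    have key : ∀ (R : Subgroup G) (hR : R = P) (f : R →* P),
        (∀ x : R, f x = (α : P ≃* P).symm ⟨x, hR ▸ x.2⟩) → f ∈ F.Hom R P →
        ((α⁻¹ : MulAut P) : P ≃* P).toMonoidHom ∈ F.Hom P P := by
      intro R hR f hf hmem
      subst hR
      convert hmem
      ext x
      exact congrArg Subtype.val (hf x).symm
    refine key _ him ((α : P ≃* P).symm.toMonoidHom.comp (Subgroup.inclusion him.le))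
      (fun x => rfl) (F.inv_mem hα _ fun x => ?_)
    exact (α : P ≃* P).symm_apply_apply x

end FusionSystem

section

variable {G : Type*} [Group G]

/-- `N_S(P)`. -/
def normalizerIn (S P : Subgroup G) : Subgroup G := S ⊓ Subgroup.normalizer (P : Set G)

/-- `C_S(P)`. -/
def centralizerIn (S P : Subgroup G) : Subgroup G := S ⊓ Subgroup.centralizer (P : Set G)

/-- `Aut_S(P)`: the automorphisms of `P` given by conjugation by elements of `N_S(P)`. -/
def autBy (S P : Subgroup G) : Subgroup (MulAut P) where
  carrier := {α | ∃ g ∈ normalizerIn S P, ∀ x : P, (α x : G) = g * x * g⁻¹}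
  one_mem' := ⟨1, Subgroup.one_mem _, fun x => by simp⟩
  mul_mem' := by
    rintro a b ⟨g, hg, h⟩ ⟨k, hk, h'⟩
    refine ⟨g * k, Subgroup.mul_mem _ hg hk, fun x => ?_⟩
    rw [MulAut.mul_apply, h, h']
    group
  inv_mem' := by
    rintro a ⟨g, hg, h⟩
    refine ⟨g⁻¹, Subgroup.inv_mem _ hg, fun x => ?_⟩
    obtain ⟨y, rfl⟩ := a.surjective x
    rw [MulAut.inv_apply_self, h]
    group

/-- `Inn(P)`. -/
def inn (P : Type*) [Group P] : Subgroup (MulAut P) := (MulAut.conj : P →* MulAut P).range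

instance inn_normal (P : Type*) [Group P] : (inn P).Normal where
  conj_mem := by
    rintro _ ⟨x, rfl⟩ α
    refine ⟨α x, ?_⟩
    ext y
    simp [MulAut.mul_apply]

end

namespace FusionSystem

variable {G : Type*} [Group G] {S : Subgroup G}

/-- `Out_F(P) = Aut_F(P) / Inn(P)`. -/
abbrev Out (F : FusionSystem S) (P : Subgroup G) (hP : P ≤ S) : Type _ :=
  F.aut P hP ⧸ (inn P).subgroupOf (F.aut P hP)

/-- `Out_S(P) = Aut_S(P) / Inn(P)`, as a subgroup of `Out_F(P)`. -/
def outBy (F : FusionSystem S) (P : Subgroup G) (hP : P ≤ S) : Subgroup (F.Out P hP) :=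
  ((autBy S P).subgroupOf (F.aut P hP)).map (QuotientGroup.mk' _)

/-- `P` is fully centralized in `F`. -/
def FullyCentralized (p : ℕ) [Fact p.Prime] (F : FusionSystem S) (P : Subgroup G) : Prop :=
  ∀ R ∈ F.conjClass P, toralOrder p (centralizerIn S R) ≤ toralOrder p (centralizerIn S P)

/-- `P` is fully normalized in `F`. -/
def FullyNormalized (p : ℕ) [Fact p.Prime] (F : FusionSystem S) (P : Subgroup G) : Prop :=
  ∀ R ∈ F.conjClass P, toralOrder p (normalizerIn S R) ≤ toralOrder p (normalizerIn S P)

/-- `P` is fully automized in `F`. -/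
def FullyAutomized (p : ℕ) (F : FusionSystem S) (P : Subgroup G) (hP : P ≤ S) : Prop :=
  Finite (F.Out P hP) ∧ IsSylow p (F.outBy P hP)

end FusionSystem

/-- `N_φ = {g ∈ N_S(Q) | φ c_g φ⁻¹ ∈ Aut_S(φ(Q))}` for a homomorphism `φ : Q → P`. -/
def extender {G : Type*} [Group G] (S : Subgroup G) {Q P : Subgroup G} (φ : Q →* P) :
    Subgroup G where
  carrier := {g | g ∈ normalizerIn S Q ∧ ∃ h ∈ normalizerIn S (image φ),
    ∀ x y : Q, (y : G) = g * x * g⁻¹ → (φ y : G) = h * φ x * h⁻¹}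
  one_mem' := ⟨Subgroup.one_mem _, 1, Subgroup.one_mem _, fun x y hxy => by
    have : y = x := Subtype.ext (by simpa using hxy)
    simp [this]⟩
  mul_mem' := by
    rintro a b ⟨ha, h, hh, H⟩ ⟨hb, k, hk, K⟩
    refine ⟨Subgroup.mul_mem _ ha hb, h * k, Subgroup.mul_mem _ hh hk, fun x y hxy => ?_⟩
    have hz : b * (x : G) * b⁻¹ ∈ Q := (Subgroup.mem_normalizer_iff.1 hb.2 x).1 x.2
    rw [H ⟨_, hz⟩ y (by rw [hxy]; group), K x ⟨_, hz⟩ rfl]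
    group
  inv_mem' := by
    rintro a ⟨ha, h, hh, H⟩
    refine ⟨Subgroup.inv_mem _ ha, h⁻¹, Subgroup.inv_mem _ hh, fun x y hxy => ?_⟩
    rw [H y x (by rw [hxy]; group)]
    group

namespace FusionSystem

variable {G : Type*} [Group G] {S : Subgroup G}

/-- `P` is receptive in `F`: every `φ ∈ Hom_F(Q, P)` with `Q ∈ P^F` extends to a morphism
`N_φ → S` of `F`. -/
def Receptive (F : FusionSystem S) (P : Subgroup G) : Prop :=
  ∀ Q ∈ F.conjClass P, ∀ φ ∈ F.Hom Q P, ∃ ψ ∈ F.Hom (extender S φ) S,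
    ∀ x : Q, ∃ hx : (x : G) ∈ extender S φ, (ψ ⟨x, hx⟩ : G) = φ x

/-- A saturated fusion system (over a discrete `p`-toral group `S`). -/
structure IsSaturated (p : ℕ) [Fact p.Prime] (F : FusionSystem S) : Prop where
  sylow_axiom : ∀ (P : Subgroup G) (hP : P ≤ S), F.FullyNormalized p P →
    F.FullyAutomized p P hP ∧ F.FullyCentralized p P
  extension_axiom : ∀ P : Subgroup G, P ≤ S → F.FullyCentralized p P → F.Receptive P
  continuity_axiom : ∀ P : Subgroup G, P ≤ S → ∀ φ : P →* S, Function.Injective φ →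
    (∀ (R : Subgroup G) (hR : R ≤ P), Finite R →
      φ.comp (Subgroup.inclusion hR) ∈ F.Hom R S) →
    φ ∈ F.Hom P S

/-- The morphism sets of the union of a sequence of fusion systems `F i` over `T i`: those
`φ : P → Q` such that for each finite `R ≤ P` there is `i` with `R ≤ T i` and
`φ|_R ∈ Hom_{F i}(R, Q ∩ T i)`. -/
def unionHom {T : ℕ → Subgroup G} (F : ∀ i, FusionSystem (T i)) (P Q : Subgroup G) :
    Set (P →* Q) :=
  {φ | ∀ (R : Subgroup G) (hR : R ≤ P), Finite R → ∃ i, R ≤ T i ∧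
    ∃ ψ ∈ (F i).Hom R (Q ⊓ T i), ∀ x : R, (ψ x : G) = φ (Subgroup.inclusion hR x)}

/-- `E` is the union of the increasing sequence `F 0 ≤ F 1 ≤ ...` of saturated fusion systems
over the finite subgroups `T 0 ≤ T 1 ≤ ...` of `S`. -/
structure IsUnion (p : ℕ) [Fact p.Prime] (E : FusionSystem S) {T : ℕ → Subgroup G}
    (F : ∀ i, FusionSystem (T i)) : Prop where
  finite : ∀ i, Finite (T i)
  mono : Monotone T
  iUnion_eq : ⋃ i, (T i : Set G) = S
  hom_mono : ∀ i j, i ≤ j → ∀ P Q : Subgroup G, P ≤ T i → Q ≤ T i →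
    (F i).Hom P Q ⊆ (F j).Hom P Q
  saturated : ∀ i, (F i).IsSaturated p
  hom_eq : ∀ P Q : Subgroup G, P ≤ S → Q ≤ S → E.Hom P Q = unionHom F P Q

end FusionSystem

/-- `H 0 ≤ H 1 ≤ ...` is an increasing sequence of finite subgroups with union `G` such that
`S ∩ H i` is a Sylow `p`-subgroup of `H i` for each `i`. -/
structure IsSylowExhaustion (p : ℕ) {G : Type*} [Group G] (S : Subgroup G)
    (H : ℕ → Subgroup G) : Prop where
  finite : ∀ i, Finite (H i)
  mono : Monotone H
  iUnion_eq : ⋃ i, (H i : Set G) = Set.univ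
  sylow : ∀ i, IsSylow p ((S ⊓ H i).subgroupOf (H i))

end Fusion

/-! Part (a) carries the difficulty: `S` can have uncountably many subgroups, so choosing one
element of `G` per morphism does not give a countable group. The remedy is to show that every
morphism is controlled by finite data. Let `T` be the torus, with `S / T` killed by `p ^ m`. For a
finite `P ≤ S`, let `B ≤ T` be generated by the `p ^ m`-th powers of elements of `P`, let `fixedIn T
B` consist of the elements of `T` fixed by everything in the normalizer of `T` that centralizes `B`,
and let `J` be its largest `p`-divisible subgroup.

Three facts suffice. Rigidity (`IsTorusIn.conj_eq_of_mem_divPart`): conjugations into `S` that agree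
on `B` agree on `J`. Extension (`IsTorusIn.exists_common_extension`,
`IsTorusIn.exists_extension_to_divPart`): every morphism on `P` extends to `P J`; the extension
axiom is applied along growing normalizers, and the continuity axiom passes to the limit. Generation
(`IsTorusIn.exists_finite_le`): every subgroup of `S` lies in `P J` for some finite subgroup `P` of
it. There are only countably many finite partial maps of `S`; one element of `G` for each extendable
one, together with `S`, generates the required countable group.

Part (b): in a chain of finite subgroups exhausting `G`, choose increasing Sylow subgroups. Their
union is a `p`-group, so it can be conjugated into `S`, and the conjugated chain is the one sought.
For any such chain each stage is a finite group with a Sylow subgroup, whose fusion system is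
saturated (`IsSylowIn.isSaturated`), and a homomorphism that is locally a conjugation is a
conjugation by the continuity axiom. -/

namespace Fusion

/-! ### Prüfer groups and the torus of a discrete `p`-toral group. -/

section Prufer

variable (p : ℕ) [Fact p.Prime]

lemma Prufer.exists_nsmul_eq_zero (a : Prufer p) : ∃ k : ℕ, p ^ k • a = 0 := by
  obtain ⟨k, hk⟩ := a.2
  exact ⟨k, Subtype.ext hk⟩

lemma Prufer.exists_nsmul_eq (a : Prufer p) : ∃ b : Prufer p, p • b = a := by
  obtain ⟨k, hk⟩ := Prufer.exists_nsmul_eq_zero p a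
  obtain ⟨⟨x⟩, hx⟩ := a
  have hp : (p : ℚ) ≠ 0 := by exact_mod_cast (Fact.out : p.Prime).ne_zero
  have hpx : p • ((x / p : ℚ) : AddCircle (1 : ℚ)) = (x : AddCircle (1 : ℚ)) := by
    rw [← AddCircle.coe_nsmul, nsmul_eq_mul, mul_div_cancel₀ _ hp]
  have hk' : p ^ k • (x : AddCircle (1 : ℚ)) = 0 := congrArg Subtype.val hk
  refine ⟨⟨((x / p : ℚ) : AddCircle (1 : ℚ)), ?_⟩, Subtype.ext hpx⟩
  refine ⟨k + 1, ?_⟩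
  change p ^ (k + 1) • ((x / p : ℚ) : AddCircle (1 : ℚ)) = 0
  rw [pow_succ, mul_smul, hpx, hk']

lemma Prufer.finite_torsion (k : ℕ) : {a : Prufer p | p ^ k • a = 0}.Finite := by
  have h := AddCircle.finite_torsion (1 : ℚ) (pow_pos (Fact.out : p.Prime).pos k)
  refine Set.Finite.of_finite_image (f := Subtype.val) (h.subset ?_)
    Subtype.val_injective.injOn
  rintro _ ⟨a, ha, rfl⟩
  exact congrArg Subtype.val ha

instance Prufer.countable : Countable (Prufer p) := by
  have : Countable (AddCircle (1 : ℚ)) :=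
    (QuotientAddGroup.mk_surjective (s := AddSubgroup.zmultiples (1 : ℚ))).countable
  infer_instance

end Prufer

/-- `T` is a normal discrete `p`-torus in `S`, recorded by the properties used here, such that
`S / T` is finite and killed by `p ^ m`. -/
structure IsTorusIn {G : Type*} [Group G] (p m : ℕ) (T S : Subgroup G) : Prop where
  le : T ≤ S
  conj_mem : ∀ s ∈ S, ∀ t ∈ T, s * t * s⁻¹ ∈ T
  comm : ∀ a ∈ T, ∀ b ∈ T, a * b = b * a
  div : ∀ a ∈ T, ∃ b ∈ T, b ^ p = a
  tors : ∀ a ∈ T, ∃ k : ℕ, a ^ p ^ k = 1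
  finite_tors : ∀ k : ℕ, {a | a ∈ T ∧ a ^ p ^ k = 1}.Finite
  pow_mem : ∀ s ∈ S, s ^ p ^ m ∈ T
  relIndex : T.relIndex S ≠ 0

lemma IsDiscreteToral.exists_isTorusIn {G : Type*} [Group G] {p : ℕ} [Fact p.Prime]
    {S : Subgroup G} (hS : IsDiscreteToral p S) :
    Countable S ∧ ∃ (T : Subgroup G) (m : ℕ), IsTorusIn p m T S := by
  obtain ⟨U, hU, ⟨r, ⟨e⟩⟩, m, hm⟩ := hS
  have hm0 : U.index ≠ 0 := by rw [hm]; exact pow_ne_zero _ (Fact.out : p.Prime).ne_zero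
  have htors : ∀ a : U, ∃ k : ℕ, a ^ p ^ k = 1 := by
    intro a
    choose k hk using fun i => Prufer.exists_nsmul_eq_zero p ((e a).toAdd i)
    refine ⟨∑ i, k i, e.injective ?_⟩
    rw [map_pow, map_one]
    apply Multiplicative.toAdd.injective
    funext i
    change p ^ (∑ i, k i) • (e a).toAdd i = 0
    rw [← Finset.sum_erase_add _ _ (Finset.mem_univ i), pow_add, mul_smul, hk, smul_zero]
  have hdiv : ∀ a : U, ∃ b : U, b ^ p = a := by
    intro a
    choose b hb using fun i => Prufer.exists_nsmul_eq p ((e a).toAdd i)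
    refine ⟨e.symm (Multiplicative.ofAdd b), e.injective ?_⟩
    rw [map_pow, e.apply_symm_apply]
    apply Multiplicative.toAdd.injective
    funext i
    exact hb i
  have hfin : ∀ k : ℕ, {a : U | a ^ p ^ k = 1}.Finite := by
    intro k
    have h := Set.Finite.pi' (ι := Fin r) (fun _ => Prufer.finite_torsion p k)
    refine Set.Finite.of_finite_image (f := fun a => (e a).toAdd) (h.subset ?_) ?_
    · rintro _ ⟨a, ha, rfl⟩ i
      have h1 : e a ^ p ^ k = 1 := by rw [← map_pow, show a ^ p ^ k = 1 from ha, map_one]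
      exact congrFun (congrArg Multiplicative.toAdd h1) i
    · exact (Multiplicative.toAdd.injective.comp e.injective).injOn
  have hcount : Countable U := (Multiplicative.toAdd.injective.comp e.injective).countable (β := Fin r → Prufer p)
  have : U.FiniteIndex := ⟨hm0⟩
  refine ⟨?_, U.map S.subtype, m, ?_⟩
  · have : Countable (S ⧸ U) := Finite.to_countable
    exact (Subgroup.groupEquivQuotientProdSubgroup (s := U)).injective.countable
  · constructor
    · rintro _ ⟨x, -, rfl⟩; exact x.2
    · rintro s hs _ ⟨x, hx, rfl⟩
      exact ⟨_, hU.conj_mem x hx ⟨s, hs⟩, rfl⟩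
    · rintro _ ⟨x, hx, rfl⟩ _ ⟨y, hy, rfl⟩
      have h : (⟨x, hx⟩ : U) * ⟨y, hy⟩ = ⟨y, hy⟩ * ⟨x, hx⟩ :=
        e.injective (by rw [map_mul, map_mul, mul_comm])
      exact congrArg (fun z : U => ((z : S) : G)) h
    · rintro _ ⟨x, hx, rfl⟩
      obtain ⟨b, hb⟩ := hdiv ⟨x, hx⟩
      exact ⟨_, ⟨b, b.2, rfl⟩, congrArg (fun z : U => ((z : S) : G)) hb⟩
    · rintro _ ⟨x, hx, rfl⟩
      obtain ⟨b, hb⟩ := htors ⟨x, hx⟩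
      exact ⟨b, congrArg (fun z : U => ((z : S) : G)) hb⟩
    · intro k
      refine ((hfin k).image (fun z : U => ((z : S) : G))).subset ?_
      rintro _ ⟨⟨x, hx, rfl⟩, h⟩
      exact ⟨⟨x, hx⟩, Subtype.ext (Subtype.ext h), rfl⟩
    · intro s hs
      have h := U.pow_index_mem ⟨s, hs⟩
      rw [hm] at h
      exact ⟨_, h, rfl⟩
    · have : (U.map S.subtype).subgroupOf S = U := by
        ext x
        simp [Subgroup.mem_subgroupOf]
      rwa [Subgroup.relIndex, this]

/-! ### Conjugation, and `F_S(H)` in terms of elements. -/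

section Conj

variable {G : Type*} [Group G]

/-- The conjugate subgroup `g P g⁻¹`. -/
def conjSubgroup (g : G) (P : Subgroup G) : Subgroup G := P.map (MulAut.conj g).toMonoidHom

lemma mem_conjSubgroup {g : G} {P : Subgroup G} {x : G} :
    x ∈ conjSubgroup g P ↔ ∃ y ∈ P, g * y * g⁻¹ = x := Iff.rfl

lemma conj_mem_conjSubgroup {g : G} {P : Subgroup G} {x : G} (hx : x ∈ P) :
    g * x * g⁻¹ ∈ conjSubgroup g P := ⟨x, hx, rfl⟩

lemma conj_mem_conjSubgroup_iff {g : G} {P : Subgroup G} {x : G} :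
    g * x * g⁻¹ ∈ conjSubgroup g P ↔ x ∈ P := by
  constructor
  · rintro ⟨y, hy, h⟩
    have : y = x := by simpa using h
    exact this ▸ hy
  · exact conj_mem_conjSubgroup

lemma conjSubgroup_le {g : G} {P Q : Subgroup G} :
    conjSubgroup g P ≤ Q ↔ ∀ x ∈ P, g * x * g⁻¹ ∈ Q := by
  constructor
  · exact fun h x hx => h (conj_mem_conjSubgroup hx)
  · rintro h _ ⟨x, hx, rfl⟩
    exact h x hx

lemma conjSubgroup_mono {g : G} {P Q : Subgroup G} (h : P ≤ Q) :
    conjSubgroup g P ≤ conjSubgroup g Q := Subgroup.map_mono h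

lemma conjSubgroup_conjSubgroup (g h : G) (P : Subgroup G) :
    conjSubgroup g (conjSubgroup h P) = conjSubgroup (g * h) P := by
  ext x
  constructor
  · rintro ⟨_, ⟨y, hy, rfl⟩, rfl⟩
    exact ⟨y, hy, by simp [mul_assoc]⟩
  · rintro ⟨y, hy, rfl⟩
    exact ⟨_, ⟨y, hy, rfl⟩, by simp [mul_assoc]⟩

lemma conjSubgroup_congr {g h : G} {P : Subgroup G}
    (hgh : ∀ x ∈ P, g * x * g⁻¹ = h * x * h⁻¹) : conjSubgroup g P = conjSubgroup h P := by
  ext x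
  constructor
  · rintro ⟨y, hy, rfl⟩
    exact ⟨y, hy, (hgh y hy).symm⟩
  · rintro ⟨y, hy, rfl⟩
    exact ⟨y, hy, hgh y hy⟩

lemma conjSubgroup_inv_conjSubgroup (g : G) (P : Subgroup G) :
    conjSubgroup g⁻¹ (conjSubgroup g P) = P := by
  rw [conjSubgroup_conjSubgroup, inv_mul_cancel]
  ext x
  simp [mem_conjSubgroup]

instance conjSubgroup_finite (g : G) (P : Subgroup G) [Finite P] : Finite (conjSubgroup g P) :=
  Finite.of_surjective (fun x : P => (⟨g * x * g⁻¹, conj_mem_conjSubgroup x.2⟩ :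
    conjSubgroup g P)) (by rintro ⟨_, x, hx, rfl⟩; exact ⟨⟨x, hx⟩, rfl⟩)

lemma card_conjSubgroup (g : G) (P : Subgroup G) : Nat.card (conjSubgroup g P) = Nat.card P :=
  (Nat.card_congr (P.equivMapOfInjective _ (MulAut.conj g).injective).toEquiv).symm

lemma conj_pow_eq (g x : G) (n : ℕ) : (g * x * g⁻¹) ^ n = g * x ^ n * g⁻¹ := conj_pow

lemma conj_mul_conj (g h x : G) : (g * h) * x * (g * h)⁻¹ = g * (h * x * h⁻¹) * g⁻¹ := by
  group

/-- Conjugation by `g` as a homomorphism `P → Q`. -/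
def conjRestrict (g : G) {P Q : Subgroup G} (h : ∀ x ∈ P, g * x * g⁻¹ ∈ Q) : P →* Q :=
  ((MulAut.conj g).toMonoidHom.comp P.subtype).codRestrict Q fun x => h x x.2

lemma coe_conjRestrict (g : G) {P Q : Subgroup G} (h : ∀ x ∈ P, g * x * g⁻¹ ∈ Q) (x : P) :
    (conjRestrict g h x : G) = g * x * g⁻¹ := rfl

lemma image_eq_conjSubgroup {P Q : Subgroup G} {φ : P →* Q} {g : G}
    (h : ∀ x : P, (φ x : G) = g * x * g⁻¹) : image φ = conjSubgroup g P := by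
  ext y
  constructor
  · rintro ⟨x, rfl⟩
    exact ⟨x, x.2, (h x).symm⟩
  · rintro ⟨x, hx, rfl⟩
    exact ⟨⟨x, hx⟩, h _⟩

variable {H S : Subgroup G} {hSH : S ≤ H}

lemma mem_conjClass_fusionSystemOf {P R : Subgroup G} (hP : P ≤ S) :
    R ∈ (fusionSystemOf H S hSH).conjClass P ↔ ∃ g ∈ H, R = conjSubgroup g P ∧ R ≤ S := by
  constructor
  · rintro ⟨φ, ⟨-, -, g, hg, h⟩, rfl⟩
    exact ⟨g, hg, image_eq_conjSubgroup h, image_le φ⟩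
  · rintro ⟨g, hg, rfl, h⟩
    have h' : ∀ x ∈ P, g * x * g⁻¹ ∈ S := conjSubgroup_le.1 h
    exact ⟨conjRestrict g h', ⟨hP, le_rfl, g, hg, fun x => rfl⟩,
      (image_eq_conjSubgroup fun x => rfl).symm⟩

/-- Receptivity in `F_S(H)` in terms of elements. -/
lemma receptive_fusionSystemOf {P Q : Subgroup G} (hP : P ≤ S) (hQ : Q ≤ S)
    (hrec : (fusionSystemOf H S hSH).Receptive Q) {h : G} (hh : h ∈ H)
    (hPQ : Q = conjSubgroup h P) :
    ∃ k ∈ H, (∀ x ∈ P, k * x * k⁻¹ = h * x * h⁻¹) ∧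
      ∀ y ∈ S, (∀ x ∈ P, y * x * y⁻¹ ∈ P) → (∀ x ∈ P, y⁻¹ * x * y ∈ P) →
        (∃ z ∈ S, ∀ x ∈ P, h * (y * x * y⁻¹) * h⁻¹ = z * (h * x * h⁻¹) * z⁻¹) →
        k * y * k⁻¹ ∈ S := by
  have hcl : P ∈ (fusionSystemOf H S hSH).conjClass Q :=
    (mem_conjClass_fusionSystemOf hQ).2
      ⟨h⁻¹, H.inv_mem hh, by rw [hPQ, conjSubgroup_inv_conjSubgroup], hP⟩
  have hmap : ∀ x ∈ P, h * x * h⁻¹ ∈ Q := conjSubgroup_le.1 hPQ.ge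
  obtain ⟨ψ, ⟨-, -, k, hk, hψ⟩, hext⟩ := hrec P hcl (conjRestrict h hmap)
    ⟨hP, hQ, h, hh, fun x => rfl⟩
  refine ⟨k, hk, fun x hx => ?_, fun y hyS hy1 hy2 ⟨z, hzS, hz⟩ => ?_⟩
  · obtain ⟨hx', h'⟩ := hext ⟨x, hx⟩
    rw [hψ] at h'
    exact h'
  · have himg : image (conjRestrict h hmap) = Q :=
      (image_eq_conjSubgroup fun x => rfl).trans hPQ.symm
    have hyN : ∀ x, x ∈ P ↔ y * x * y⁻¹ ∈ P := fun x =>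
      ⟨hy1 x, fun h => by simpa [mul_assoc] using hy2 _ h⟩
    have hy : y ∈ extender S (conjRestrict h hmap) := by
      refine ⟨⟨hyS, Subgroup.mem_normalizer_iff.2 hyN⟩, z, ⟨hzS, ?_⟩, ?_⟩
      · rw [himg]
        refine Subgroup.mem_normalizer_iff.2 fun w => ?_
        rw [hPQ]
        constructor
        · rintro ⟨x, hx, rfl⟩
          exact ⟨_, hy1 x hx, hz x hx⟩
        · rintro ⟨x, hx, hxw⟩
          refine ⟨y⁻¹ * x * y, hy2 x hx, ?_⟩
          have h1 := hz _ (hy2 x hx)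
          have hxw' : h * x * h⁻¹ = z * w * z⁻¹ := hxw
          rw [show y * (y⁻¹ * x * y) * y⁻¹ = x by group, hxw'] at h1
          simpa using h1.symm
      · intro x x' hxx
        rw [coe_conjRestrict, coe_conjRestrict, hxx]
        exact hz x x.2
    have h1 := hψ ⟨y, hy⟩
    exact h1 ▸ (ψ ⟨y, hy⟩).2

end Conj

/-! ### Orders of discrete `p`-toral groups. -/

lemma IsDiscreteTorusOfRank.congr {p : ℕ} [Fact p.Prime] {U V : Type*} [Group U] [Group V]
    (e : U ≃* V) (r : ℕ) : IsDiscreteTorusOfRank p U r ↔ IsDiscreteTorusOfRank p V r :=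
  ⟨fun ⟨f⟩ => ⟨e.symm.trans f⟩, fun ⟨f⟩ => ⟨e.trans f⟩⟩

lemma torusRank_congr {p : ℕ} [Fact p.Prime] {U V : Type*} [Group U] [Group V]
    (e : U ≃* V) : torusRank p U = torusRank p V := by
  classical
  have h : ∀ r, IsDiscreteTorusOfRank p U r ↔ IsDiscreteTorusOfRank p V r :=
    fun r => IsDiscreteTorusOfRank.congr e r
  by_cases hU : IsDiscreteTorus p U
  · have hV : IsDiscreteTorus p V := hU.imp fun r => (h r).1
    rw [torusRank, torusRank, dif_pos hU, dif_pos hV]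
    exact Nat.find_congr' fun {r} => h r
  · have hV : ¬ IsDiscreteTorus p V := fun hV => hU (hV.imp fun r => (h r).2)
    rw [torusRank, torusRank, dif_neg hU, dif_neg hV]

lemma mem_identityComponent {A : Type*} [Group A] {x : A} :
    x ∈ identityComponent A ↔ ∀ U : Subgroup A, U.FiniteIndex → x ∈ U := by
  simp [identityComponent, Subgroup.mem_iInf]

/-- Finite index is transitive, so the finite-index subgroups of `C` are cofinal among those of `A`.
-/
lemma identityComponent_eq_map {A : Type*} [Group A] (C : Subgroup A) [hC : C.FiniteIndex] :
    identityComponent A = (identityComponent C).map C.subtype := by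
  ext x
  constructor
  · intro hx
    rw [mem_identityComponent] at hx
    refine ⟨⟨x, hx C hC⟩, mem_identityComponent.2 fun V hV => ?_, rfl⟩
    have hfin : (V.map C.subtype).FiniteIndex :=
      ⟨by rw [Subgroup.index_map_subtype]; exact mul_ne_zero hV.index_ne_zero hC.index_ne_zero⟩
    obtain ⟨y, hy, hyx⟩ := hx _ hfin
    have : y = ⟨x, hx C hC⟩ := Subtype.ext hyx
    exact this ▸ hy
  · rintro ⟨y, hy, rfl⟩
    refine mem_identityComponent.2 fun U hU => ?_
    exact Subgroup.mem_subgroupOf.1 (mem_identityComponent.1 hy (U.subgroupOf C) inferInstance)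

/-- Orders can thus be compared through a convenient subgroup of finite index, without knowing that
the identity component is a torus. -/
lemma toralOrder_eq (p : ℕ) [Fact p.Prime] {A : Type*} [Group A] (C : Subgroup A)
    [C.FiniteIndex] : toralOrder p A =
      toLex (torusRank p (identityComponent C), (identityComponent C).index * C.index) := by
  rw [toralOrder, identityComponent_eq_map C, Subgroup.index_map_subtype]
  rw [← torusRank_congr ((identityComponent C).equivMapOfInjective C.subtype
    C.subtype_injective)]

lemma identityComponent_map_equiv {A B : Type*} [Group A] [Group B] (e : A ≃* B) :
    (identityComponent A).map e.toMonoidHom = identityComponent B := by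
  ext x
  constructor
  · rintro ⟨y, hy, rfl⟩
    refine mem_identityComponent.2 fun U hU => ?_
    have : (U.comap e.toMonoidHom).FiniteIndex :=
      ⟨by rw [U.index_comap_of_surjective e.surjective]; exact hU.index_ne_zero⟩
    exact mem_identityComponent.1 hy _ this
  · intro hx
    refine ⟨e.symm x, mem_identityComponent.2 fun U hU => ?_, e.apply_symm_apply x⟩
    have : (U.comap e.symm.toMonoidHom).FiniteIndex :=
      ⟨by rw [U.index_comap_of_surjective e.symm.surjective]; exact hU.index_ne_zero⟩
    exact mem_identityComponent.1 hx _ this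

lemma toralOrder_of_finite (p : ℕ) [Fact p.Prime] (A : Type*) [Group A] [Finite A] :
    toralOrder p A = toLex (0, Nat.card A) := by
  classical
  have : Subsingleton (identityComponent (⊥ : Subgroup A)) := inferInstance
  have h0 : torusRank p (identityComponent (⊥ : Subgroup A)) = 0 := by
    have hr : IsDiscreteTorusOfRank p (identityComponent (⊥ : Subgroup A)) 0 := by
      refine ⟨⟨⟨fun _ => 1, fun _ => 1, fun x => Subsingleton.elim _ _, fun x => ?_⟩,
        fun x y => (one_mul _).symm⟩⟩
      apply Multiplicative.toAdd.injective
      exact Subsingleton.elim _ _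
    have h : IsDiscreteTorus p (identityComponent (⊥ : Subgroup A)) := ⟨0, hr⟩
    rw [torusRank, dif_pos h]
    exact (Nat.find_eq_zero h).2 hr
  have h1 : (identityComponent (⊥ : Subgroup A)).index = 1 := by
    rw [Subgroup.index_eq_one]
    exact Subsingleton.elim _ _
  rw [toralOrder_eq p ⊥, h0, h1, one_mul, Subgroup.index_bot]

/-! ### Existence of fully normalized conjugates. -/

section

variable {G : Type*} [Group G] {p m : ℕ} {T S : Subgroup G}

lemma toralOrder_eq_of_le (p : ℕ) [Fact p.Prime] {C N : Subgroup G} (hCN : C ≤ N)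
    (h : C.relIndex N ≠ 0) : toralOrder p N =
      toLex (torusRank p (identityComponent C), (identityComponent C).index * C.relIndex N) := by
  have : (C.subgroupOf N).FiniteIndex := ⟨h⟩
  let e := Subgroup.subgroupOfEquivOfLe hCN
  rw [toralOrder_eq p (C.subgroupOf N), ← identityComponent_map_equiv e,
    Subgroup.index_map_of_bijective e.bijective,
    ← torusRank_congr ((identityComponent _).equivMapOfInjective _ e.injective)]
  rfl

/-- Since `T` is abelian, the centralizer of `R` in `T` depends only on the image of `R` in the
finite quotient `S / T`. -/
lemma IsTorusIn.finite_centralizers (hT : IsTorusIn p m T S) :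
    {C | ∃ R ≤ S, C = T ⊓ Subgroup.centralizer (R : Set G)}.Finite := by
  have : (T.subgroupOf S).FiniteIndex := ⟨hT.relIndex⟩
  let X := S ⧸ T.subgroupOf S
  let f : Set X → Subgroup G := fun A => T ⊓ ⨅ q ∈ A, Subgroup.centralizer {((q.out : S) : G)}
  refine (Set.finite_range f).subset ?_
  rintro _ ⟨R, hR, rfl⟩
  refine ⟨{q | ∃ r : S, (r : G) ∈ R ∧ q = QuotientGroup.mk r}, ?_⟩
  have key : ∀ t ∈ T, ∀ r : S,
      (((QuotientGroup.mk r : X).out : S) : G) * t = t * ((QuotientGroup.mk r : X).out : S) ↔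
        (r : G) * t = t * r := by
    intro t ht r
    obtain ⟨⟨u, hu⟩, h⟩ := QuotientGroup.mk_out_eq_mul (T.subgroupOf S) r
    have hut : (u : G) * t = t * u := hT.comm _ (Subgroup.mem_subgroupOf.1 hu) _ ht
    rw [h]
    simp only [Subgroup.coe_mul]
    rw [mul_assoc, hut, ← mul_assoc, ← mul_assoc, mul_left_inj]
  ext t
  simp only [f, Subgroup.mem_inf, Subgroup.mem_iInf, Subgroup.mem_centralizer_iff,
    Set.mem_singleton_iff, forall_eq, Set.mem_ofPred_eq, SetLike.mem_coe]
  refine and_congr_right fun ht => ⟨fun h r hr => ?_, ?_⟩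
  · exact (key t ht ⟨r, hR hr⟩).1 (h _ ⟨⟨r, hR hr⟩, hr, rfl⟩)
  · rintro h _ ⟨r, hr, rfl⟩
    exact (key t ht r).2 (h r hr)

/-- `N` modulo the centralizer embeds in `Aut(R)`, hence in the self-maps of `R`. The crude bound is
enough because it depends only on the cardinality of `R`. -/
lemma relIndex_centralizer_le (R N : Subgroup G) [Finite R]
    (hN : N ≤ Subgroup.normalizer (R : Set G)) :
    (Subgroup.centralizer (R : Set G)).relIndex N ≠ 0 ∧
      (Subgroup.centralizer (R : Set G)).relIndex N ≤ Nat.card R ^ Nat.card R := by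
  have hcard : (Subgroup.centralizer (R : Set G)).relIndex (Subgroup.normalizer (R : Set G)) =
      Nat.card R.normalizerMonoidHom.range := by
    rw [← Subgroup.index_ker, Subgroup.normalizerMonoidHom_ker]
    rfl
  have : Finite (MulAut R) := Finite.of_injective (fun α : MulAut R => (α : R → R))
    DFunLike.coe_injective
  have h0 : (Subgroup.centralizer (R : Set G)).relIndex
      (Subgroup.normalizer (R : Set G)) ≠ 0 := by
    rw [hcard]; exact Nat.card_pos.ne'
  refine ⟨fun h => h0 (Subgroup.relIndex_eq_zero_of_le_right hN h),
    (Subgroup.relIndex_le_of_le_right hN h0).trans ?_⟩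
  rw [hcard, ← Nat.card_fun]
  exact Nat.card_le_card_of_injective
    (fun α : R.normalizerMonoidHom.range => ((α : MulAut R) : R → R))
    (DFunLike.coe_injective.comp Subtype.val_injective)

variable {H : Subgroup G} {hSH : S ≤ H}

/-- Every finite subgroup of `S` has a fully normalized conjugate. -/
lemma IsTorusIn.exists_fullyNormalized [Fact p.Prime] (hT : IsTorusIn p m T S) {P : Subgroup G}
    (hP : P ≤ S) [Finite P] :
    ∃ g ∈ H, conjSubgroup g P ≤ S ∧
      (fusionSystemOf H S hSH).FullyNormalized p (conjSubgroup g P) := by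
  -- A maximal order exists because only finitely many occur: `N_S(R)` contains `C_T(R)`, one of
  -- finitely many subgroups, with index at most `M`, and these two data determine the order.
  let M := T.relIndex S * (Nat.card P ^ Nat.card P)
  let V := (fun R => toralOrder p (normalizerIn S R)) '' (fusionSystemOf H S hSH).conjClass P
  have hV : V.Finite := by
    refine ((hT.finite_centralizers.prod (Set.finite_Iic M)).image
      (fun x : Subgroup G × ℕ => toLex (torusRank p (identityComponent x.1),
        (identityComponent x.1).index * x.2))).subset ?_
    rintro _ ⟨R, hR, rfl⟩
    obtain ⟨g, hg, rfl, hRS⟩ := (mem_conjClass_fusionSystemOf hP).1 hR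
    set R := conjSubgroup g P
    set C := T ⊓ Subgroup.centralizer (R : Set G)
    have hCN : C ≤ normalizerIn S R :=
      le_inf (inf_le_left.trans hT.le) (inf_le_right.trans (Subgroup.centralizer_le_normalizer _))
    have h1 := relIndex_centralizer_le R (normalizerIn S R) inf_le_right
    have h2 := Subgroup.relIndex_le_of_le_right (K := normalizerIn S R) inf_le_left hT.relIndex
    have h3 : T.relIndex (normalizerIn S R) ≠ 0 :=
      fun h => hT.relIndex (Subgroup.relIndex_eq_zero_of_le_right inf_le_left h)
    have hle : C.relIndex (normalizerIn S R) ≤ M := by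
      refine Subgroup.relIndex_inf_le.trans (Nat.mul_le_mul h2 ?_)
      rw [← card_conjSubgroup g P]
      exact h1.2
    exact ⟨(C, C.relIndex (normalizerIn S R)), ⟨⟨R, hRS, rfl⟩, hle⟩,
      (toralOrder_eq_of_le p hCN (Subgroup.relIndex_inf_ne_zero h3 h1.1)).symm⟩
  have hne : V.Nonempty :=
    ⟨_, P, (mem_conjClass_fusionSystemOf hP).2 ⟨1, H.one_mem, by ext; simp [mem_conjSubgroup], hP⟩,
      rfl⟩
  obtain ⟨_, ⟨Q, hQ, rfl⟩, hmax⟩ := Set.exists_max_image V id hV hne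
  obtain ⟨g, hg, rfl, hQS⟩ := (mem_conjClass_fusionSystemOf hP).1 hQ
  refine ⟨g, hg, hQS, fun R hR => hmax _ ⟨R, ?_, rfl⟩⟩
  obtain ⟨k, hk, rfl, hRS⟩ := (mem_conjClass_fusionSystemOf hQS).1 hR
  rw [conjSubgroup_conjSubgroup] at hRS ⊢
  exact (mem_conjClass_fusionSystemOf hP).2 ⟨_, H.mul_mem hk hg, rfl, hRS⟩

end

/-! ### A normal `p`-subgroup of the automorphism group. -/

section Automorphisms

variable {Q : Type*} [Group Q]

/-- The automorphisms of `Q` that are trivial on the centralizer `D` of the `n`-th powers and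
on `Q / D`. -/
def stabilizingAut (Q : Type*) [Group Q] (n : ℕ) : Subgroup (MulAut Q) where
  carrier := {α | (∀ d ∈ Subgroup.centralizer (Set.range fun q : Q => q ^ n), α d = d) ∧
    ∀ q, α q * q⁻¹ ∈ Subgroup.centralizer (Set.range fun q : Q => q ^ n)}
  one_mem' := ⟨fun _ _ => rfl, fun q => by simp⟩
  mul_mem' := by
    rintro α β ⟨ha, ha'⟩ ⟨hb, hb'⟩
    refine ⟨fun d hd => by rw [MulAut.mul_apply, hb d hd, ha d hd], fun q => ?_⟩
    have := Subgroup.mul_mem _ (ha' (β q)) (hb' q)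
    simpa [mul_assoc] using this
  inv_mem' := by
    rintro α ⟨ha, ha'⟩
    refine ⟨fun d hd => ?_, fun q => ?_⟩
    · rw [MulAut.inv_apply, MulEquiv.symm_apply_eq, ha d hd]
    · have := Subgroup.inv_mem _ (ha' (α⁻¹ q))
      simpa using this

lemma map_mem_centralizer_powers (α : MulAut Q) {n : ℕ} {d : Q}
    (hd : d ∈ Subgroup.centralizer (Set.range fun q : Q => q ^ n)) :
    α d ∈ Subgroup.centralizer (Set.range fun q : Q => q ^ n) := by
  rw [Subgroup.mem_centralizer_iff] at hd ⊢
  rintro _ ⟨q, rfl⟩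
  have h := congrArg α (hd _ ⟨α⁻¹ q, rfl⟩)
  simpa using h

instance stabilizingAut_normal (n : ℕ) : (stabilizingAut Q n).Normal where
  conj_mem := by
    rintro α ⟨ha, ha'⟩ β
    refine ⟨fun d hd => ?_, fun q => ?_⟩
    · rw [MulAut.mul_apply, MulAut.mul_apply, ha _ (map_mem_centralizer_powers _ hd),
        MulAut.apply_inv_self]
    · have := map_mem_centralizer_powers β (ha' (β⁻¹ q))
      simpa [MulAut.mul_apply] using this

/-- Such an `α` sends `q` to `d q` with `d` fixed by `α`, so `α ^ k` sends `q` to `d ^ k q`. -/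
lemma isPGroup_stabilizingAut {p : ℕ} [Fact p.Prime] [Finite Q] (hQ : IsPGroup p Q) (n : ℕ) :
    IsPGroup p (stabilizingAut Q n) := by
  obtain ⟨j, hj⟩ := IsPGroup.iff_card.1 hQ
  rintro ⟨α, ha, ha'⟩
  refine ⟨j, Subtype.ext (MulEquiv.ext fun q => ?_)⟩
  have h : ∀ k : ℕ, (α ^ k) q = (α q * q⁻¹) ^ k * q := by
    intro k
    induction k with
    | zero => simp
    | succ k ih =>
      rw [pow_succ', MulAut.mul_apply, ih, map_mul, map_pow, ha _ (ha' q), pow_succ]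
      group
  have h1 := h (p ^ j)
  rw [← hj, pow_card_eq_one', one_mul, hj] at h1
  exact h1

lemma IsSylow.le_of_normal {O : Type*} [Group O] {p : ℕ} {X Y : Subgroup O} [hX : X.Normal]
    (hY : IsSylow p Y) (hXp : IsPGroup p X) : X ≤ Y := by
  obtain ⟨g, hg⟩ := hY.2 X hXp
  intro x hx
  have := hg _ (hX.conj_mem x hx g⁻¹)
  simpa [mul_assoc] using this

end Automorphisms

/-! ### The torus: divisibility, fixed subgroups and divisible parts. -/

section

variable {G : Type*} [Group G] {p m : ℕ} {T S : Subgroup G}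

lemma conj_eq_of_conj_eq {a b x y : G} (h : a * x * a⁻¹ = b * y * b⁻¹) :
    (b⁻¹ * a) * x * (b⁻¹ * a)⁻¹ = y := by
  rw [conj_mul_conj, h]
  group

lemma IsTorusIn.le_normalizer (hT : IsTorusIn p m T S) :
    S ≤ Subgroup.normalizer (T : Set G) := by
  intro s hs
  refine Subgroup.mem_normalizer_iff.2 fun t => ⟨hT.conj_mem s hs t, fun h => ?_⟩
  simpa [mul_assoc] using hT.conj_mem s⁻¹ (S.inv_mem hs) _ h

lemma IsTorusIn.isPGroup (hT : IsTorusIn p m T S) : IsPGroup p S := by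
  rintro ⟨s, hs⟩
  obtain ⟨k, hk⟩ := hT.tors _ (hT.pow_mem s hs)
  exact ⟨m + k, Subtype.ext (by rw [pow_add, pow_mul]; exact hk)⟩

lemma exists_pow_prime_pow_eq {D : Subgroup G} (hD : ∀ d ∈ D, ∃ e ∈ D, e ^ p = d) (k : ℕ) :
    ∀ d ∈ D, ∃ e ∈ D, e ^ p ^ k = d := by
  induction k with
  | zero => exact fun d hd => ⟨d, hd, by simp⟩
  | succ k ih =>
    intro d hd
    obtain ⟨e, he, rfl⟩ := ih d hd
    obtain ⟨f, hf, rfl⟩ := hD e he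
    exact ⟨f, hf, by rw [pow_succ', pow_mul]⟩

/-- `p`-divisible subgroups are carried into the torus. -/
lemma IsTorusIn.conj_mem_of_div (hT : IsTorusIn p m T S) {D : Subgroup G}
    (hD : ∀ d ∈ D, ∃ e ∈ D, e ^ p = d) {g : G} (hg : ∀ d ∈ D, g * d * g⁻¹ ∈ S) :
    ∀ d ∈ D, g * d * g⁻¹ ∈ T := by
  intro d hd
  obtain ⟨e, he, rfl⟩ := exists_pow_prime_pow_eq hD m d hd
  rw [← conj_pow_eq]
  exact hT.pow_mem _ (hg e he)

/-- Divisibility forces `g T g⁻¹ ≤ T`. Equality follows because each `p ^ k`-torsion subgroup of `T`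
is finite, so an injective map of it into itself is onto. -/
lemma IsTorusIn.mem_normalizer (hT : IsTorusIn p m T S) {g : G}
    (hg : ∀ t ∈ T, g * t * g⁻¹ ∈ S) : g ∈ Subgroup.normalizer (T : Set G) := by
  have hg' := hT.conj_mem_of_div hT.div hg
  refine Subgroup.mem_normalizer_iff.2 fun t => ⟨hg' t, fun h => ?_⟩
  obtain ⟨k, hk⟩ := hT.tors _ h
  have hinj : Function.Injective fun t => g * t * g⁻¹ := (MulAut.conj g).injective
  have himg : (fun t => g * t * g⁻¹) '' {a | a ∈ T ∧ a ^ p ^ k = 1} =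
      {a | a ∈ T ∧ a ^ p ^ k = 1} := by
    refine Set.eq_of_subset_of_ncard_le ?_ (Set.ncard_image_of_injective _ hinj).ge
      (hT.finite_tors k)
    rintro _ ⟨a, ⟨ha, hak⟩, rfl⟩
    exact ⟨hg' a ha, by simp only [conj_pow_eq, hak, mul_one, mul_inv_cancel]⟩
  have hmem : g * t * g⁻¹ ∈ {a | a ∈ T ∧ a ^ p ^ k = 1} := ⟨h, hk⟩
  rw [← himg] at hmem
  obtain ⟨a, ⟨ha, -⟩, hat⟩ := hmem
  exact hinj hat ▸ ha

/-- The subgroup generated by the `n`-th powers of elements of `P`. -/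
def powSubgroup (n : ℕ) (P : Subgroup G) : Subgroup G :=
  Subgroup.closure ((fun x => x ^ n) '' (P : Set G))

lemma pow_mem_powSubgroup {n : ℕ} {P : Subgroup G} {x : G} (hx : x ∈ P) :
    x ^ n ∈ powSubgroup n P := Subgroup.subset_closure ⟨x, hx, rfl⟩

lemma powSubgroup_le {n : ℕ} {P Q : Subgroup G} :
    powSubgroup n P ≤ Q ↔ ∀ x ∈ P, x ^ n ∈ Q := by
  rw [powSubgroup, Subgroup.closure_le]
  exact ⟨fun h x hx => h ⟨x, hx, rfl⟩, by rintro h _ ⟨x, hx, rfl⟩; exact h x hx⟩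

lemma powSubgroup_le_self {n : ℕ} {P : Subgroup G} : powSubgroup n P ≤ P :=
  powSubgroup_le.2 fun _ hx => P.pow_mem hx n

lemma powSubgroup_mono {n : ℕ} {P Q : Subgroup G} (h : P ≤ Q) :
    powSubgroup n P ≤ powSubgroup n Q :=
  powSubgroup_le.2 fun _ hx => pow_mem_powSubgroup (h hx)

lemma powSubgroup_conjSubgroup (n : ℕ) (g : G) (P : Subgroup G) :
    powSubgroup n (conjSubgroup g P) = conjSubgroup g (powSubgroup n P) := by
  apply le_antisymm
  · refine powSubgroup_le.2 ?_
    rintro _ ⟨x, hx, rfl⟩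
    exact ⟨x ^ n, pow_mem_powSubgroup hx, map_pow _ _ _⟩
  · rw [conjSubgroup, Subgroup.map_le_iff_le_comap, powSubgroup_le]
    intro x hx
    have := pow_mem_powSubgroup (n := n) (conj_mem_conjSubgroup (g := g) hx)
    rwa [conj_pow_eq] at this

lemma IsTorusIn.powSubgroup_le (hT : IsTorusIn p m T S) {P : Subgroup G} (hP : P ≤ S) :
    powSubgroup (p ^ m) P ≤ T :=
  Fusion.powSubgroup_le.2 fun x hx => hT.pow_mem x (hP hx)

/-- The elements of `T` fixed by all elements of the normalizer of `T` that centralize `B`. -/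
def fixedIn (T B : Subgroup G) : Subgroup G :=
  T ⊓ Subgroup.centralizer
    ((Subgroup.normalizer (T : Set G) ⊓ Subgroup.centralizer (B : Set G) : Subgroup G) : Set G)

lemma mem_fixedIn {B : Subgroup G} {t : G} : t ∈ fixedIn T B ↔ t ∈ T ∧
    ∀ n ∈ Subgroup.normalizer (T : Set G), (∀ b ∈ B, n * b * n⁻¹ = b) → n * t * n⁻¹ = t := by
  simp only [fixedIn, Subgroup.mem_inf, Subgroup.mem_centralizer_iff, SetLike.mem_coe,
    mul_inv_eq_iff_eq_mul]
  refine and_congr_right fun _ => ⟨fun h n hn hb => h n ⟨hn, fun b hb' => (hb b hb').symm⟩,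
    fun h n hn => h n hn.1 fun b hb => (hn.2 b hb).symm⟩

lemma fixedIn_anti_of {B B' : Subgroup G} (h : ∀ n ∈ Subgroup.normalizer (T : Set G),
    (∀ b ∈ B', n * b * n⁻¹ = b) → ∀ b ∈ B, n * b * n⁻¹ = b) : fixedIn T B ≤ fixedIn T B' :=
  fun _ ht => mem_fixedIn.2 ⟨(mem_fixedIn.1 ht).1,
    fun n hn hb => (mem_fixedIn.1 ht).2 n hn (h n hn hb)⟩

lemma fixedIn_mono {B B' : Subgroup G} (h : B ≤ B') : fixedIn T B ≤ fixedIn T B' :=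
  fixedIn_anti_of fun _ _ hb _ hb' => hb _ (h hb')

/-- `fixedIn T` behaves as a closure operator; this keeps it unchanged while `P` is enlarged by
elements of `fixedIn T B`. -/
lemma fixedIn_eq_of_le {B B' : Subgroup G} (h : B ≤ B') (h' : B' ≤ fixedIn T B) :
    fixedIn T B' = fixedIn T B :=
  le_antisymm (fixedIn_anti_of fun n hn hb _ hb' => (mem_fixedIn.1 (h' hb')).2 n hn hb)
    (fixedIn_mono h)

lemma le_fixedIn {B : Subgroup G} (hB : B ≤ T) :
    B ≤ fixedIn T B :=
  fun _ hb => mem_fixedIn.2 ⟨hB hb, fun _ _ h => h _ hb⟩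

/-- Elements inducing the same map on `B` induce the same map on `fixedIn T B`. -/
lemma conj_eq_on_fixedIn {B : Subgroup G} {n n' : G} (hn : n ∈ Subgroup.normalizer (T : Set G))
    (hn' : n' ∈ Subgroup.normalizer (T : Set G))
    (h : ∀ b ∈ B, n * b * n⁻¹ = n' * b * n'⁻¹) :
    ∀ t ∈ fixedIn T B, n * t * n⁻¹ = n' * t * n'⁻¹ := by
  intro t ht
  have := (mem_fixedIn.1 ht).2 (n'⁻¹ * n) (Subgroup.mul_mem _ (Subgroup.inv_mem _ hn') hn)
    fun b hb => conj_eq_of_conj_eq (h b hb)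
  rw [conj_mul_conj] at this
  nth_rw 2 [← this]
  group

lemma conjSubgroup_fixedIn {n : G} (hn : n ∈ Subgroup.normalizer (T : Set G)) (B : Subgroup G) :
    conjSubgroup n (fixedIn T B) = fixedIn T (conjSubgroup n B) := by
  have key : ∀ n ∈ Subgroup.normalizer (T : Set G), ∀ B : Subgroup G,
      conjSubgroup n (fixedIn T B) ≤ fixedIn T (conjSubgroup n B) := by
    intro n hn B
    refine conjSubgroup_le.2 fun t ht => mem_fixedIn.2
      ⟨(Subgroup.mem_normalizer_iff.1 hn t).1 (mem_fixedIn.1 ht).1, fun k hk hb => ?_⟩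
    have hkn := Subgroup.mul_mem _ hk hn
    have := conj_eq_on_fixedIn hkn hn (B := B) (fun b hb' => by
      rw [conj_mul_conj]; exact hb _ (conj_mem_conjSubgroup hb')) t ht
    rwa [conj_mul_conj] at this
  refine le_antisymm (key n hn B) ?_
  have h := conjSubgroup_mono (g := n)
    (key n⁻¹ (Subgroup.inv_mem _ hn) (conjSubgroup n B))
  rw [conjSubgroup_inv_conjSubgroup] at h
  have h2 := conjSubgroup_inv_conjSubgroup n⁻¹ (fixedIn T (conjSubgroup n B))
  rw [inv_inv] at h2
  rwa [h2] at h

/-- The largest `p`-divisible subgroup of an abelian group `X`. -/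
def divPart (p : ℕ) (X : Subgroup G) : Subgroup G :=
  Subgroup.closure {x | ∃ D ≤ X, (∀ d ∈ D, ∃ e ∈ D, e ^ p = d) ∧ x ∈ D}

lemma divPart_le {X : Subgroup G} : divPart p X ≤ X :=
  (Subgroup.closure_le _).2 fun _ ⟨_, hD, _, hx⟩ => hD hx

lemma le_divPart {X D : Subgroup G} (hD : D ≤ X) (h : ∀ d ∈ D, ∃ e ∈ D, e ^ p = d) :
    D ≤ divPart p X :=
  fun _ hx => Subgroup.subset_closure ⟨D, hD, h, hx⟩

lemma divPart_mono {X Y : Subgroup G} (h : X ≤ Y) : divPart p X ≤ divPart p Y :=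
  Subgroup.closure_mono fun _ ⟨D, hD, h', hx⟩ => ⟨D, hD.trans h, h', hx⟩

/-- In an abelian group a product of `p`-th powers is a `p`-th power, so the subgroup generated by
the divisible subgroups is itself divisible. -/
lemma exists_pow_eq_of_mem_divPart {X : Subgroup G} (hX : ∀ a ∈ X, ∀ b ∈ X, a * b = b * a) :
    ∀ x ∈ divPart p X, ∃ y ∈ divPart p X, y ^ p = x := by
  intro x hx
  induction hx using Subgroup.closure_induction with
  | mem x hx =>
    obtain ⟨D, hD, h, hx⟩ := hx
    obtain ⟨y, hy, rfl⟩ := h x hx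
    exact ⟨y, le_divPart hD h hy, rfl⟩
  | one => exact ⟨1, Subgroup.one_mem _, one_pow _⟩
  | mul x y _ _ hx hy =>
    obtain ⟨a, ha, rfl⟩ := hx
    obtain ⟨b, hb, rfl⟩ := hy
    exact ⟨a * b, Subgroup.mul_mem _ ha hb,
      (show Commute a b from hX a (divPart_le ha) b (divPart_le hb)).mul_pow p⟩
  | inv x _ hx =>
    obtain ⟨a, ha, rfl⟩ := hx
    exact ⟨a⁻¹, Subgroup.inv_mem _ ha, inv_pow _ _⟩

lemma conj_exists_pow_eq {D : Subgroup G} (hD : ∀ d ∈ D, ∃ e ∈ D, e ^ p = d) (g : G) :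
    ∀ d ∈ conjSubgroup g D, ∃ e ∈ conjSubgroup g D, e ^ p = d := by
  rintro _ ⟨d, hd, rfl⟩
  obtain ⟨e, he, rfl⟩ := hD d hd
  exact ⟨g * e * g⁻¹, conj_mem_conjSubgroup he, conj_pow_eq _ _ _⟩

lemma conj_mem_divPart {X Y : Subgroup G} (hX : ∀ a ∈ X, ∀ b ∈ X, a * b = b * a) {g : G}
    (h : conjSubgroup g X ≤ Y) :
    ∀ x ∈ divPart p X, g * x * g⁻¹ ∈ divPart p Y := by
  intro x hx
  exact le_divPart ((conjSubgroup_mono divPart_le).trans h)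
    (conj_exists_pow_eq (exists_pow_eq_of_mem_divPart hX) g) (conj_mem_conjSubgroup hx)

lemma IsTorusIn.comm_of_le (hT : IsTorusIn p m T S) {X : Subgroup G} (hX : X ≤ T) :
    ∀ a ∈ X, ∀ b ∈ X, a * b = b * a := fun a ha b hb => hT.comm a (hX ha) b (hX hb)

lemma fixedIn_le {B : Subgroup G} : fixedIn T B ≤ T := inf_le_left

end

/-! ### Rigidity and the conditions for extension. -/

section

variable {G : Type*} [Group G] {p m : ℕ} [Fact p.Prime] {T S : Subgroup G}

/-- An element normalizing a fully normalized finite subgroup `Q`, whose action is trivial on the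
centralizer `D` in `Q` of the `n`-th powers and on `Q / D`, acts on `Q` as an element of `S`. -/
lemma exists_mem_conj_eq_of_fullyNormalized (hS : IsPGroup p S)
    (hsat : (fusionSystemOf ⊤ S le_top).IsSaturated p) {Q : Subgroup G} [Finite Q] (hQ : Q ≤ S)
    (hfn : (fusionSystemOf ⊤ S le_top).FullyNormalized p Q) (n : ℕ) {c : G}
    (hc : ∀ x, x ∈ Q ↔ c * x * c⁻¹ ∈ Q)
    (hc1 : ∀ d ∈ Q, (∀ q ∈ Q, q ^ n * d = d * q ^ n) → c * d * c⁻¹ = d)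
    (hc2 : ∀ r ∈ Q, ∀ q ∈ Q, q ^ n * (c * r * c⁻¹ * r⁻¹) = (c * r * c⁻¹ * r⁻¹) * q ^ n) :
    ∃ z ∈ S, ∀ x ∈ Q, c * x * c⁻¹ = z * x * z⁻¹ := by
  set F := fusionSystemOf ⊤ S le_top
  obtain ⟨⟨-, hsyl⟩, -⟩ := hsat.sylow_axiom Q hQ hfn
  let α : MulAut Q := MulDistribMulAction.toMulAut (Subgroup.normalizer (Q : Set G)) Q
    ⟨c, Subgroup.mem_normalizer_iff.2 hc⟩
  have hα : ∀ x : Q, (α x : G) = c * x * c⁻¹ := fun x => rfl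
  have hαF : α ∈ F.aut Q hQ := ⟨hQ, hQ, c, trivial, hα⟩
  have hαK : α ∈ stabilizingAut Q n := by
    refine ⟨fun d hd => Subtype.ext ?_, fun q => ?_⟩
    · rw [Subgroup.mem_centralizer_iff] at hd
      exact hc1 d d.2 fun q hq => congrArg Subtype.val (hd _ ⟨⟨q, hq⟩, rfl⟩)
    · rw [Subgroup.mem_centralizer_iff]
      rintro _ ⟨r, rfl⟩
      exact Subtype.ext (hc2 q q.2 r r.2)
  let K := (stabilizingAut Q n).subgroupOf (F.aut Q hQ)
  let π := QuotientGroup.mk' ((inn Q).subgroupOf (F.aut Q hQ))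
  have hK : IsPGroup p K := (isPGroup_stabilizingAut (hS.to_le hQ) n).comap_subtype
  -- The image of `K` in `Out_F(Q)` is a normal `p`-subgroup, so the Sylow subgroup `Out_S(Q)`
  -- contains it.
  have hnormal : (K.map π).Normal :=
    Subgroup.Normal.map inferInstance π (QuotientGroup.mk'_surjective _)
  have hle := hsyl.le_of_normal (hK.map π)
  obtain ⟨β, ⟨z, hz, hβ⟩, h⟩ := hle (⟨⟨α, hαF⟩, hαK, rfl⟩ : π ⟨α, hαF⟩ ∈ K.map π)
  obtain ⟨y, hy⟩ := Subgroup.mem_subgroupOf.1 ((QuotientGroup.eq).1 h)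
  -- Lifting from `Out_F(Q)` to `Aut_F(Q)` costs an inner automorphism, which is conjugation by some
  -- `y` in `Q ≤ S`.
  refine ⟨z * y, S.mul_mem hz.1 (hQ y.2), fun x hx => ?_⟩
  have h1 : α = β.1 * MulAut.conj y := by
    have hy' : MulAut.conj y = (β.1)⁻¹ * α := hy
    rw [hy', mul_inv_cancel_left]
  rw [← hα ⟨x, hx⟩, h1, MulAut.mul_apply, conj_mul_conj]
  exact hβ _

/-- Fully normalized subgroups are fully centralized, hence receptive. -/
lemma exists_extension_of_fullyNormalized
    (hsat : (fusionSystemOf ⊤ S le_top).IsSaturated p) {P : Subgroup G} {h : G} (hP : P ≤ S)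
    (hQ : conjSubgroup h P ≤ S)
    (hfn : (fusionSystemOf ⊤ S le_top).FullyNormalized p (conjSubgroup h P)) :
    ∃ k, (∀ x ∈ P, k * x * k⁻¹ = h * x * h⁻¹) ∧
      ∀ y ∈ S, (∀ x ∈ P, y * x * y⁻¹ ∈ P) → (∀ x ∈ P, y⁻¹ * x * y ∈ P) →
        (∃ z ∈ S, ∀ x ∈ P, h * (y * x * y⁻¹) * h⁻¹ = z * (h * x * h⁻¹) * z⁻¹) →
        k * y * k⁻¹ ∈ S := by
  obtain ⟨k, -, hk⟩ := receptive_fusionSystemOf hP hQ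
    (hsat.extension_axiom _ hQ (hsat.sylow_axiom _ hQ hfn).2) (Subgroup.mem_top h) rfl
  exact ⟨k, hk⟩

/-- Morphisms to fully normalized subgroups extend to the centralizer. -/
lemma exists_extension_to_centralizer
    (hsat : (fusionSystemOf ⊤ S le_top).IsSaturated p) {P : Subgroup G} {h : G} (hP : P ≤ S)
    (hQ : conjSubgroup h P ≤ S)
    (hfn : (fusionSystemOf ⊤ S le_top).FullyNormalized p (conjSubgroup h P)) :
    ∃ k, (∀ x ∈ P, k * x * k⁻¹ = h * x * h⁻¹) ∧
      ∀ y ∈ S, (∀ x ∈ P, y * x * y⁻¹ = x) → k * y * k⁻¹ ∈ S := by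
  obtain ⟨k, hk, hk'⟩ := exists_extension_of_fullyNormalized hsat hP hQ hfn
  refine ⟨k, hk, fun y hy hyP => hk' y hy (fun x hx => (hyP x hx).symm ▸ hx) (fun x hx => ?_)
    ⟨1, S.one_mem, fun x hx => by rw [hyP x hx]; simp⟩⟩
  have h1 : y⁻¹ * x * y = x := by
    nth_rw 1 [← hyP x hx]
    group
  exact h1.symm ▸ hx

/-- A morphism between finite subgroups of the torus is induced by an element normalizing it. -/
lemma IsTorusIn.exists_normalizer_conj_eq (hT : IsTorusIn p m T S)
    (hsat : (fusionSystemOf ⊤ S le_top).IsSaturated p) {X : Subgroup G} [Finite X]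
    (hX : X ≤ T) {g : G} (hg : ∀ x ∈ X, g * x * g⁻¹ ∈ T) :
    ∃ n ∈ Subgroup.normalizer (T : Set G), ∀ x ∈ X, n * x * n⁻¹ = g * x * g⁻¹ := by
  have hXS := hX.trans hT.le
  have hgX : conjSubgroup g X ≤ T := conjSubgroup_le.2 hg
  obtain ⟨h, -, hQ, hfn⟩ := hT.exists_fullyNormalized (H := ⊤) (hSH := le_top) hXS
  have hcj : conjSubgroup (h * g⁻¹) (conjSubgroup g X) = conjSubgroup h X := by
    rw [conjSubgroup_conjSubgroup, inv_mul_cancel_right]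
  have hcent : ∀ Y ≤ T, ∀ y ∈ T, ∀ x ∈ Y, y * x * y⁻¹ = x := fun Y hY y hy x hx => by
    rw [hT.comm y hy x (hY hx), mul_inv_cancel_right]
  -- `T` centralizes both `X` and `g X g⁻¹`, so the maps from both to one fully normalized conjugate
  -- extend over `T`. The extending elements normalize `T`, and so does the quotient `k₂⁻¹ * k₁`,
  -- which induces `g` on `X`.
  obtain ⟨k₁, hk₁, hk₁'⟩ := exists_extension_to_centralizer hsat hXS hQ hfn
  obtain ⟨k₂, hk₂, hk₂'⟩ := exists_extension_to_centralizer (P := conjSubgroup g X)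
    (h := h * g⁻¹) hsat (hgX.trans hT.le) (by rwa [hcj]) (by rwa [hcj])
  have h1 := hT.mem_normalizer fun t ht => hk₁' t (hT.le ht) (hcent X hX t ht)
  have h2 := hT.mem_normalizer fun t ht => hk₂' t (hT.le ht) (hcent _ hgX t ht)
  refine ⟨k₂⁻¹ * k₁, Subgroup.mul_mem _ (Subgroup.inv_mem _ h2) h1, fun x hx => ?_⟩
  apply conj_eq_of_conj_eq
  rw [hk₁ x hx, hk₂ _ (conj_mem_conjSubgroup hx), ← conj_mul_conj, inv_mul_cancel_right]

/-- A morphism that maps `B` to the torus is determined on `divPart p (fixedIn T B)` by its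
restriction to `B`. -/
lemma IsTorusIn.conj_eq_of_mem_divPart (hG : IsLocallyFiniteGroup G) (hT : IsTorusIn p m T S)
    (hsat : (fusionSystemOf ⊤ S le_top).IsSaturated p) {B : Subgroup G} [Finite B]
    (hB : B ≤ T) {n g x : G} (hn : n ∈ Subgroup.normalizer (T : Set G))
    (hng : ∀ b ∈ B, g * b * g⁻¹ = n * b * n⁻¹) (hx : x ∈ divPart p (fixedIn T B))
    (hgx : g * x * g⁻¹ ∈ S) : g * x * g⁻¹ = n * x * n⁻¹ := by
  have hxI := divPart_le hx
  have hxT := fixedIn_le hxI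
  let X : Subgroup G := Subgroup.closure ((B : Set G) ∪ {x})
  have : Finite X := hG X ((Subgroup.fg_iff _).2
    ⟨_, rfl, (Set.toFinite (B : Set G)).union (Set.finite_singleton x)⟩)
  have hBX : B ≤ X := fun b hb => Subgroup.subset_closure (Or.inl hb)
  have hxX : x ∈ X := Subgroup.subset_closure (Or.inr rfl)
  have hle : ∀ (k : G) (Y : Subgroup G), (∀ b ∈ B, k * b * k⁻¹ ∈ Y) → k * x * k⁻¹ ∈ Y →
      ∀ y ∈ X, k * y * k⁻¹ ∈ Y := by
    intro k Y h1 h2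
    have h3 : X ≤ Y.comap (MulAut.conj k).toMonoidHom := by
      refine (Subgroup.closure_le _).2 ?_
      rintro y (hy | rfl)
      exacts [h1 y hy, h2]
    exact fun y hy => h3 hy
  have hXT : X ≤ T := (Subgroup.closure_le _).2 (Set.union_subset hB (by simpa using hxT))
  have hnT : ∀ t ∈ T, n * t * n⁻¹ ∈ T := fun t => (Subgroup.mem_normalizer_iff.1 hn t).1
  have hgXS : conjSubgroup g X ≤ S := conjSubgroup_le.2
    (hle g S (fun b hb => hT.le (by rw [hng b hb]; exact hnT b (hB hb))) hgx)
  have hXS := hXT.trans hT.le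
  obtain ⟨h, -, hQ, hfn⟩ := hT.exists_fullyNormalized (H := ⊤) (hSH := le_top) hXS
  have hcj : conjSubgroup (h * g⁻¹) (conjSubgroup g X) = conjSubgroup h X := by
    rw [conjSubgroup_conjSubgroup, inv_mul_cancel_right]
  obtain ⟨k₁, hk₁, hk₁'⟩ := exists_extension_to_centralizer hsat hXS hQ hfn
  obtain ⟨k₂, hk₂, hk₂'⟩ := exists_extension_to_centralizer (P := conjSubgroup g X)
    (h := h * g⁻¹) hsat hgXS (by rwa [hcj]) (by rwa [hcj])
  have hk₁N := hT.mem_normalizer fun t ht => hk₁' t (hT.le ht) fun y hy => by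
    rw [hT.comm t ht y (hXT hy), mul_inv_cancel_right]
  have hk₂X : ∀ y ∈ X, k₂ * (g * y * g⁻¹) * k₂⁻¹ = h * y * h⁻¹ := fun y hy => by
    rw [hk₂ _ (conj_mem_conjSubgroup hy), ← conj_mul_conj, inv_mul_cancel_right]
  have hgxB : ∀ b ∈ B, (g * x * g⁻¹) * (n * b * n⁻¹) * (g * x * g⁻¹)⁻¹ = n * b * n⁻¹ := by
    intro b hb
    have hxb : x * b = b * x := hT.comm x hxT b (hB hb)
    rw [← hng b hb, mul_inv_eq_iff_eq_mul]
    calc g * x * g⁻¹ * (g * b * g⁻¹) = g * (x * b) * g⁻¹ := by group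
      _ = g * b * g⁻¹ * (g * x * g⁻¹) := by rw [hxb]; group
  -- `g x g⁻¹` lies in `S`, so normalizes `T`, and it centralizes `n B n⁻¹`. Therefore it fixes
  -- `fixedIn T (n B n⁻¹) = n (fixedIn T B) n⁻¹` pointwise, and the conjugate of `J` by `n`
  -- centralizes all of `g X g⁻¹`.
  have hcentr : ∀ y ∈ divPart p (fixedIn T B), ∀ z ∈ conjSubgroup g X,
      (n * y * n⁻¹) * z * (n * y * n⁻¹)⁻¹ = z := by
    intro y hy
    have hyT := fixedIn_le (divPart_le hy)
    have hny : n * y * n⁻¹ ∈ fixedIn T (conjSubgroup n B) := by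
      rw [← conjSubgroup_fixedIn hn]
      exact conj_mem_conjSubgroup (divPart_le hy)
    have h1 : (g * x * g⁻¹) * (n * y * n⁻¹) * (g * x * g⁻¹)⁻¹ = n * y * n⁻¹ :=
      (mem_fixedIn.1 hny).2 _ (hT.le_normalizer hgx)
        (by rintro _ ⟨b, hb, rfl⟩; exact hgxB b hb)
    rintro _ ⟨z, hz, rfl⟩
    have h2 := hle g (Subgroup.centralizer {n * y * n⁻¹}) (fun b hb => by
      rw [Subgroup.mem_centralizer_singleton_iff, hng b hb]
      exact hT.comm _ (hnT b (hB hb)) _ (hnT y hyT)) (by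
      rw [Subgroup.mem_centralizer_singleton_iff]
      exact mul_inv_eq_iff_eq_mul.1 h1) z hz
    rw [Subgroup.mem_centralizer_singleton_iff] at h2
    rw [mul_inv_eq_iff_eq_mul]
    exact h2.symm
  have hdiv := exists_pow_eq_of_mem_divPart (p := p)
    (hT.comm_of_le (fixedIn_le (T := T) (B := B)))
  -- Here divisibility is essential: `k₂` carries `n J n⁻¹` a priori only into `S`.
  have hk₂J : ∀ y ∈ divPart p (fixedIn T B), (k₂ * n) * y * (k₂ * n)⁻¹ ∈ T :=
    hT.conj_mem_of_div hdiv fun y hy => by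
      rw [conj_mul_conj]
      exact hk₂' _ (hT.le (hnT y (fixedIn_le (divPart_le hy)))) (hcentr y hy)
  have hkB : ∀ b ∈ B, (k₁⁻¹ * (k₂ * n)) * b * (k₁⁻¹ * (k₂ * n))⁻¹ = b := fun b hb =>
    conj_eq_of_conj_eq (by
      rw [conj_mul_conj, ← hng b hb, hk₂X b (hBX hb), hk₁ b (hBX hb)])
  have hkx : (k₁⁻¹ * (k₂ * n)) * x * (k₁⁻¹ * (k₂ * n))⁻¹ ∈ T := by
    rw [conj_mul_conj]
    exact (Subgroup.mem_normalizer_iff.1 (Subgroup.inv_mem _ hk₁N) _).1 (hk₂J x hx)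
  -- `k₁⁻¹ k₂ n` fixes `B` and sends `x` into `T`, so on `X` it is induced by some `ν` normalizing
  -- `T`. As `ν` centralizes `B`, it fixes `x`; hence `k₁` and `k₂ n` agree at `x`, as do `k₁` and
  -- `k₂ g`.
  obtain ⟨ν, hν, hνX⟩ := hT.exists_normalizer_conj_eq hsat hXT
    (hle _ T (fun b hb => by rw [hkB b hb]; exact hB hb) hkx)
  have h3 := (mem_fixedIn.1 hxI).2 ν hν fun b hb => by rw [hνX b (hBX hb), hkB b hb]
  rw [hνX x hxX] at h3
  have h4 : k₂ * (n * x * n⁻¹) * k₂⁻¹ = h * x * h⁻¹ := by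
    rw [← hk₁ x hxX]
    nth_rw 2 [← h3]
    group
  rw [← hk₂X x hxX] at h4
  simpa using h4.symm

/-- For `y` in `fixedIn T B`, where `B` is generated by the `p ^ m`-th powers of elements of `P`,
the conditions of the extension axiom hold. -/
lemma IsTorusIn.exists_conj_eq_of_mem_fixedIn (hT : IsTorusIn p m T S)
    (hsat : (fusionSystemOf ⊤ S le_top).IsSaturated p) {P : Subgroup G} [Finite P] {h : G}
    (hP : P ≤ S) (hQ : conjSubgroup h P ≤ S)
    (hfn : (fusionSystemOf ⊤ S le_top).FullyNormalized p (conjSubgroup h P)) {y : G}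
    (hy : y ∈ fixedIn T (powSubgroup (p ^ m) P)) (hyP : ∀ x, x ∈ P ↔ y * x * y⁻¹ ∈ P) :
    ∃ z ∈ S, ∀ x ∈ P, h * (y * x * y⁻¹) * h⁻¹ = z * (h * x * h⁻¹) * z⁻¹ := by
  have hcom : ∀ x ∈ P, (h * y * h⁻¹) * (h * x * h⁻¹) * (h * y * h⁻¹)⁻¹ =
      h * (y * x * y⁻¹) * h⁻¹ := fun x _ => by group
  have hyT := fixedIn_le hy
  have key := exists_mem_conj_eq_of_fullyNormalized hT.isPGroup hsat hQ hfn (p ^ m)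
    (c := h * y * h⁻¹) ?_ ?_ ?_
  · obtain ⟨z, hz, hz'⟩ := key
    exact ⟨z, hz, fun x hx => by rw [← hcom x hx]; exact hz' _ (conj_mem_conjSubgroup hx)⟩
  · intro x
    obtain ⟨x, rfl⟩ : ∃ w, x = h * w * h⁻¹ := ⟨h⁻¹ * x * h, by group⟩
    rw [conj_mem_conjSubgroup_iff, show (h * y * h⁻¹) * (h * x * h⁻¹) * (h * y * h⁻¹)⁻¹ =
      h * (y * x * y⁻¹) * h⁻¹ by group, conj_mem_conjSubgroup_iff]
    exact hyP x
  -- An element `d` commuting with the `p ^ m`-th powers centralizes `B` and normalizes `T`, so it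
  -- commutes with `y` by the definition of `fixedIn`.
  · rintro _ ⟨d, hd, rfl⟩ hcomm
    change (h * y * h⁻¹) * (h * d * h⁻¹) * (h * y * h⁻¹)⁻¹ = h * d * h⁻¹
    have h1 : ∀ b ∈ powSubgroup (p ^ m) P, d * b * d⁻¹ = b := by
      have h2 : powSubgroup (p ^ m) P ≤ Subgroup.centralizer {d} := by
        refine Fusion.powSubgroup_le.2 fun x hx => ?_
        rw [Subgroup.mem_centralizer_singleton_iff]
        have h3 : (h * x * h⁻¹) ^ p ^ m * (h * d * h⁻¹) = (h * d * h⁻¹) * (h * x * h⁻¹) ^ p ^ m :=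
          hcomm _ (conj_mem_conjSubgroup hx)
        refine (MulAut.conj h).injective ?_
        simpa only [map_mul, map_pow, MulAut.conj_apply] using h3
      intro b hb
      have := Subgroup.mem_centralizer_singleton_iff.1 (h2 hb)
      rw [mul_inv_eq_iff_eq_mul, this]
    have h4 := (mem_fixedIn.1 hy).2 d (hT.le_normalizer (hP hd)) h1
    rw [hcom d hd]
    congr 2
    rw [mul_inv_eq_iff_eq_mul] at h4 ⊢
    exact h4.symm
  -- The commutator of `y` and `r` lies in the abelian group `T`, which also contains every `p ^
  -- m`-th power.
  · rintro _ ⟨r, hr, rfl⟩ _ ⟨q, hq, rfl⟩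
    change (h * q * h⁻¹) ^ p ^ m * ((h * y * h⁻¹) * (h * r * h⁻¹) * (h * y * h⁻¹)⁻¹ *
      (h * r * h⁻¹)⁻¹) = ((h * y * h⁻¹) * (h * r * h⁻¹) * (h * y * h⁻¹)⁻¹ *
      (h * r * h⁻¹)⁻¹) * (h * q * h⁻¹) ^ p ^ m
    have h1 : y * r * y⁻¹ * r⁻¹ ∈ T := by
      have := T.mul_mem hyT (hT.conj_mem r (hP hr) _ (T.inv_mem hyT))
      rwa [show y * (r * y⁻¹ * r⁻¹) = y * r * y⁻¹ * r⁻¹ by group] at this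
    have h2 := hT.comm _ (hT.pow_mem q (hP hq)) _ h1
    rw [show (h * y * h⁻¹) * (h * r * h⁻¹) * (h * y * h⁻¹)⁻¹ * (h * r * h⁻¹)⁻¹ =
      h * (y * r * y⁻¹ * r⁻¹) * h⁻¹ by group, conj_pow_eq]
    calc h * q ^ p ^ m * h⁻¹ * (h * (y * r * y⁻¹ * r⁻¹) * h⁻¹)
        = h * (q ^ p ^ m * (y * r * y⁻¹ * r⁻¹)) * h⁻¹ := by
          generalize q ^ p ^ m = a
          group
      _ = _ := by
          rw [h2]
          generalize q ^ p ^ m = a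
          group

end

/-! ### Common extensions along growing normalizers. -/

section

variable {G : Type*} [Group G] {p m : ℕ} {T S : Subgroup G}

/-- Modulo a subgroup normalized by `x`, the powers of `x y` and `x` coincide. It locates the `p ^
m`-th powers of elements of `P Y` inside `fixedIn T B`. -/
lemma exists_mul_pow_eq {I : Subgroup G} {x y : G} (hx : ∀ i ∈ I, x * i * x⁻¹ ∈ I) (hy : y ∈ I)
    (k : ℕ) : ∃ i ∈ I, (x * y) ^ k = i * x ^ k := by
  induction k with
  | zero => exact ⟨1, I.one_mem, by simp⟩
  | succ k ih =>
    obtain ⟨i, hi, h⟩ := ih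
    exact ⟨_, hx _ (I.mul_mem hy hi), by rw [pow_succ', h, pow_succ']; group⟩

lemma conjSubgroup_eq_self {P : Subgroup G} {x : G} (hx : x ∈ P) : conjSubgroup x P = P := by
  apply le_antisymm (conjSubgroup_le.2 fun y hy => P.mul_mem (P.mul_mem hx hy) (P.inv_mem hx))
  intro y hy
  exact ⟨x⁻¹ * y * x, P.mul_mem (P.mul_mem (P.inv_mem hx) hy) hx, by
    change x * (x⁻¹ * y * x) * x⁻¹ = y
    group⟩

lemma conj_mem_powSubgroup {P : Subgroup G} {x b : G} {n : ℕ} (hx : x ∈ P)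
    (hb : b ∈ powSubgroup n P) : x * b * x⁻¹ ∈ powSubgroup n P := by
  have := conj_mem_conjSubgroup (g := x) hb
  rwa [← powSubgroup_conjSubgroup, conjSubgroup_eq_self hx] at this

lemma IsTorusIn.conj_mem_fixedIn_powSubgroup (hT : IsTorusIn p m T S) {P : Subgroup G} {x i : G}
    {n : ℕ} (hP : P ≤ S) (hx : x ∈ P) (hi : i ∈ fixedIn T (powSubgroup n P)) :
    x * i * x⁻¹ ∈ fixedIn T (powSubgroup n P) := by
  have := conj_mem_conjSubgroup (g := x) hi
  rwa [conjSubgroup_fixedIn (hT.le_normalizer (hP hx)), ← powSubgroup_conjSubgroup,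
    conjSubgroup_eq_self hx] at this

lemma exists_eq_mul_of_mem_sup {P Y : Subgroup G} (h : ∀ x ∈ P, ∀ y ∈ Y, x * y * x⁻¹ ∈ Y) {z : G}
    (hz : z ∈ P ⊔ Y) : ∃ x ∈ P, ∃ y ∈ Y, x * y = z := by
  have hle : P ≤ Subgroup.normalizer (Y : Set G) := fun x hx =>
    Subgroup.mem_normalizer_iff.2 fun y => ⟨h x hx y, fun hy => by
      simpa [mul_assoc] using h x⁻¹ (P.inv_mem hx) _ hy⟩
  rw [← SetLike.mem_coe, Subgroup.coe_mul_of_left_le_normalizer_right P Y hle] at hz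
  exact hz

lemma finite_sup {P Y : Subgroup G} [Finite P] [Finite Y]
    (h : ∀ x ∈ P, ∀ y ∈ Y, x * y * x⁻¹ ∈ Y) : Finite (P ⊔ Y : Subgroup G) := by
  refine ((Set.toFinite (P : Set G)).mul (Set.toFinite (Y : Set G))).subset fun z hz => ?_
  obtain ⟨x, hx, y, hy, rfl⟩ := exists_eq_mul_of_mem_sup h hz
  exact Set.mul_mem_mul hx hy

variable [Fact p.Prime]

/-- Normalizers grow: if the finite `p`-group `P` normalizes `Y ≰ P`, then some element of
`Y \ P` normalizes `P`. -/
lemma exists_mem_normalizer_notMem {P Y : Subgroup G} [Finite P] [Finite Y]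
    (hS : IsPGroup p S) (hP : P ≤ S) (hY : Y ≤ S) (h : ∀ x ∈ P, ∀ y ∈ Y, x * y * x⁻¹ ∈ Y)
    (hYP : ¬ Y ≤ P) : ∃ y ∈ Y, y ∈ Subgroup.normalizer (P : Set G) ∧ y ∉ P := by
  have := finite_sup h
  set L := P ⊔ Y
  have hL : IsPGroup p L := hS.to_le (sup_le hP hY)
  have := hL.isNilpotent
  have hlt : P.subgroupOf L < ⊤ := by
    rw [lt_top_iff_ne_top, ne_eq, Subgroup.subgroupOf_eq_top]
    exact fun hLP => hYP (le_sup_right.trans hLP)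
  obtain ⟨⟨z, hz⟩, hzN, hzP⟩ := SetLike.exists_of_lt (Group.normalizerCondition_of_isNilpotent _ hlt)
  -- The factor `x` lies in `P`, so it can be removed without leaving the normalizer of `P`.
  obtain ⟨x, hx, y, hy, rfl⟩ := exists_eq_mul_of_mem_sup h hz
  rw [Subgroup.mem_subgroupOf] at hzP
  have hxyN : x * y ∈ Subgroup.normalizer (P : Set G) := by
    refine Subgroup.mem_normalizer_iff.2 fun w => ?_
    rw [Subgroup.mem_normalizer_iff] at hzN
    constructor
    · intro hw
      exact Subgroup.mem_subgroupOf.1 ((hzN ⟨w, (le_sup_left : P ≤ L) hw⟩).1 hw)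
    · intro hw
      have hwL : w ∈ L := by
        have h1 := L.mul_mem (L.mul_mem (L.inv_mem hz) ((le_sup_left : P ≤ L) hw)) hz
        rwa [show (x * y)⁻¹ * (x * y * w * (x * y)⁻¹) * (x * y) = w by group] at h1
      exact Subgroup.mem_subgroupOf.1 ((hzN ⟨w, hwL⟩).2 (Subgroup.mem_subgroupOf.2 hw))
  refine ⟨y, hy, ?_, fun hyP => hzP (P.mul_mem hx hyP)⟩
  have := Subgroup.mul_mem _ (Subgroup.inv_mem _ (Subgroup.le_normalizer hx)) hxyN
  rwa [inv_mul_cancel_left] at this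

/-- The morphism induced by `g` on a finite subgroup `P`, and the map induced on
`Y ≤ divPart p (fixedIn T B)` by an element `n` of the normalizer of `T` which agrees with `g` on
the group `B` generated by the `p ^ m`-th powers, have a common extension. -/
theorem IsTorusIn.exists_common_extension (hG : IsLocallyFiniteGroup G)
    (hT : IsTorusIn p m T S) (hsat : (fusionSystemOf ⊤ S le_top).IsSaturated p) (k : ℕ) :
    ∀ (P Y : Subgroup G) [Finite P] [Finite Y], P ≤ S →
      Y ≤ divPart p (fixedIn T (powSubgroup (p ^ m) P)) →
      (∀ x ∈ P, ∀ y ∈ Y, x * y * x⁻¹ ∈ Y) → ((Y : Set G) \ P).ncard ≤ k →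
      ∀ g : G, (∀ x ∈ P, g * x * g⁻¹ ∈ S) → ∀ n ∈ Subgroup.normalizer (T : Set G),
      (∀ b ∈ powSubgroup (p ^ m) P, g * b * g⁻¹ = n * b * n⁻¹) →
      ∃ g', (∀ x ∈ P, g' * x * g'⁻¹ = g * x * g⁻¹) ∧
        ∀ y ∈ Y, g' * y * g'⁻¹ = n * y * n⁻¹ := by
  induction k using Nat.strong_induction_on with
  | _ k ih =>
  -- The case of a fully normalized target. The induction hypothesis it uses concerns a larger `P`
  -- and an arbitrary target.
  have hnorm : ∀ (P Y : Subgroup G) [Finite P] [Finite Y], P ≤ S →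
      Y ≤ divPart p (fixedIn T (powSubgroup (p ^ m) P)) →
      (∀ x ∈ P, ∀ y ∈ Y, x * y * x⁻¹ ∈ Y) → ((Y : Set G) \ P).ncard ≤ k →
      ∀ h : G, conjSubgroup h P ≤ S →
      (fusionSystemOf ⊤ S le_top).FullyNormalized p (conjSubgroup h P) →
      ∀ n ∈ Subgroup.normalizer (T : Set G),
      (∀ b ∈ powSubgroup (p ^ m) P, h * b * h⁻¹ = n * b * n⁻¹) →
      ∃ h', (∀ x ∈ P, h' * x * h'⁻¹ = h * x * h⁻¹) ∧
        ∀ y ∈ Y, h' * y * h'⁻¹ = n * y * n⁻¹ := by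
    intro P Y _ _ hP hYJ hPY hk h hQ hfn n hn hnh
    set B := powSubgroup (p ^ m) P with hBdef
    have hBT : B ≤ T := hT.powSubgroup_le hP
    have hBfin : Finite B := Finite.of_injective _ (Subgroup.inclusion_injective
      (powSubgroup_le_self : B ≤ P))
    have hYI : Y ≤ fixedIn T B := hYJ.trans divPart_le
    have hYT : Y ≤ T := hYI.trans fixedIn_le
    -- If `Y ≤ P` there is nothing to extend, and rigidity gives the agreement with `n`.
    by_cases hYP : Y ≤ P
    · exact ⟨h, fun _ _ => rfl, fun y hy => hT.conj_eq_of_mem_divPart hG hsat hBT hn hnh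
        (hYJ hy) (conjSubgroup_le.1 hQ y (hYP hy))⟩
    obtain ⟨y₀, hy₀, hy₀N, hy₀P⟩ := exists_mem_normalizer_notMem hT.isPGroup hP
      (hYT.trans hT.le) hPY hYP
    obtain ⟨h₁, hh₁, hh₁'⟩ := exists_extension_of_fullyNormalized hsat hP hQ hfn
    set P₁ := P ⊔ (Y ⊓ Subgroup.normalizer (P : Set G))
    have hPP₁ : P ≤ P₁ := le_sup_left
    have hP₁S : P₁ ≤ S := sup_le hP (inf_le_left.trans (hYT.trans hT.le))
    have hP₁ : P₁ ≤ P ⊔ Y := sup_le_sup_left inf_le_left _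
    have hP₁fin : Finite P₁ := by
      have := finite_sup hPY
      exact Finite.of_injective _ (Subgroup.inclusion_injective hP₁)
    have hh₁P₁ : conjSubgroup h₁ P₁ ≤ S := by
      rw [conjSubgroup, Subgroup.map_le_iff_le_comap]
      refine sup_le (fun x hx => ?_) fun y hy => ?_
      · change h₁ * x * h₁⁻¹ ∈ S
        rw [hh₁ x hx]
        exact conjSubgroup_le.1 hQ x hx
      · have hyN := Subgroup.mem_normalizer_iff.1 hy.2
        refine hh₁' y (hT.le (hYT hy.1)) (fun x hx => (hyN x).1 hx) (fun x hx => ?_)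
          (hT.exists_conj_eq_of_mem_fixedIn hsat hP hQ hfn (hYI hy.1) hyN)
        rw [hyN]
        simpa [mul_assoc] using hx
    have hBB₁ : B ≤ powSubgroup (p ^ m) P₁ := powSubgroup_mono hPP₁
    -- Passing from `P` to `P₁` enlarges the group of powers only within `fixedIn T B`, so the
    -- condition on `Y` persists.
    have hB₁ : fixedIn T (powSubgroup (p ^ m) P₁) = fixedIn T B := by
      refine fixedIn_eq_of_le hBB₁ (Fusion.powSubgroup_le.2 fun z hz => ?_)
      obtain ⟨x, hx, y, hy, rfl⟩ := exists_eq_mul_of_mem_sup hPY (hP₁ hz)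
      obtain ⟨i, hi, h⟩ := exists_mul_pow_eq
        (fun i hi => hT.conj_mem_fixedIn_powSubgroup hP hx hi) (hYI hy) (p ^ m)
      rw [h]
      exact Subgroup.mul_mem _ hi (le_fixedIn hBT (pow_mem_powSubgroup hx))
    have hB₁fin : Finite (powSubgroup (p ^ m) P₁) := Finite.of_injective _
      (Subgroup.inclusion_injective (powSubgroup_le_self : _ ≤ P₁))
    obtain ⟨n₁, hn₁, hn₁h⟩ := hT.exists_normalizer_conj_eq hsat (hT.powSubgroup_le hP₁S)
      (g := h₁) (fun b hb => hT.powSubgroup_le hh₁P₁ (by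
        rw [powSubgroup_conjSubgroup]; exact conj_mem_conjSubgroup hb))
    have hlt : ((Y : Set G) \ P₁).ncard < k := by
      refine lt_of_lt_of_le (Set.ncard_lt_ncard ⟨Set.sdiff_subset_sdiff_right hPP₁, fun hsub => ?_⟩
        ((Set.toFinite _).sdiff)) hk
      exact (hsub ⟨hy₀, hy₀P⟩).2 ((le_sup_right : _ ≤ P₁) ⟨hy₀, hy₀N⟩)
    obtain ⟨h₂, hh₂, hh₂'⟩ := ih _ hlt P₁ Y hP₁S (by rw [hB₁]; exact hYJ)
      (fun z hz w hw => by
        obtain ⟨x, hx, y, hy, rfl⟩ := exists_eq_mul_of_mem_sup hPY (hP₁ hz)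
        rw [conj_mul_conj]
        exact hPY x hx _ (Y.mul_mem (Y.mul_mem hy hw) (Y.inv_mem hy)))
      le_rfl h₁ (conjSubgroup_le.1 hh₁P₁) n₁ hn₁ (fun b hb => (hn₁h b hb).symm)
    refine ⟨h₂, fun x hx => (hh₂ x (hPP₁ hx)).trans (hh₁ x hx), fun y hy => ?_⟩
    rw [hh₂' y hy]
    -- `n₁` was chosen for `P₁`, but it agrees with `n` on `B`, hence on `fixedIn T B`.
    refine conj_eq_on_fixedIn hn₁ hn (fun b hb => ?_) y (hYI hy)
    rw [hn₁h b (hBB₁ hb), hh₁ b (powSubgroup_le_self hb), hnh b hb]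
  intro P Y _ _ hP hYJ hPY hk g hg n hn hng
  set B := powSubgroup (p ^ m) P with hBdef
  have hBT : B ≤ T := hT.powSubgroup_le hP
  have hBfin : Finite B := Finite.of_injective _ (Subgroup.inclusion_injective
    (powSubgroup_le_self : B ≤ P))
  have hYI : Y ≤ fixedIn T B := hYJ.trans divPart_le
  have hgS : conjSubgroup g P ≤ S := conjSubgroup_le.2 hg
  -- For an arbitrary target, `P` and `g P g⁻¹` have a common fully normalized conjugate. Both maps
  -- to it are extended, and one extension is composed with the inverse of the other.
  obtain ⟨h, -, hQ, hfn⟩ := hT.exists_fullyNormalized (H := ⊤) (hSH := le_top) hP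
  have hcj : conjSubgroup (h * g⁻¹) (conjSubgroup g P) = conjSubgroup h P := by
    rw [conjSubgroup_conjSubgroup, inv_mul_cancel_right]
  obtain ⟨ν, hν, hνh⟩ := hT.exists_normalizer_conj_eq hsat hBT (g := h)
    (fun b hb => hT.powSubgroup_le hQ (by
        rw [powSubgroup_conjSubgroup]; exact conj_mem_conjSubgroup hb))
  obtain ⟨h₂, hh₂, hh₂'⟩ := hnorm P Y hP hYJ hPY hk h hQ hfn ν hν fun b hb => (hνh b hb).symm
  have hpow : powSubgroup (p ^ m) (conjSubgroup g P) = conjSubgroup n B := by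
    rw [powSubgroup_conjSubgroup]
    exact conjSubgroup_congr hng
  have hfix : fixedIn T (powSubgroup (p ^ m) (conjSubgroup g P)) =
      conjSubgroup n (fixedIn T B) := by
    rw [hpow, conjSubgroup_fixedIn hn]
  -- `g x g⁻¹` and `n x n⁻¹` act equally on `n B n⁻¹`, hence on its `fixedIn`; so `g P g⁻¹`
  -- normalizes `n Y n⁻¹`.
  have hact : ∀ x ∈ P, ∀ y ∈ Y, (g * x * g⁻¹) * (n * y * n⁻¹) * (g * x * g⁻¹)⁻¹ =
      n * (x * y * x⁻¹) * n⁻¹ := by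
    intro x hx y hy
    have hxN := hT.le_normalizer (hP hx)
    rw [conj_eq_on_fixedIn (hT.le_normalizer (hg x hx))
      (Subgroup.mul_mem _ (Subgroup.mul_mem _ hn hxN) (Subgroup.inv_mem _ hn))
      (B := conjSubgroup n B) ?_ _
      (by rw [← conjSubgroup_fixedIn hn]; exact conj_mem_conjSubgroup (hYI hy))]
    · group
    · rintro _ ⟨b, hb, rfl⟩
      change (g * x * g⁻¹) * (n * b * n⁻¹) * (g * x * g⁻¹)⁻¹ =
        (n * x * n⁻¹) * (n * b * n⁻¹) * (n * x * n⁻¹)⁻¹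
      have h1 := hng _ (conj_mem_powSubgroup hx hb)
      rw [← hng b hb, show (g * x * g⁻¹) * (g * b * g⁻¹) * (g * x * g⁻¹)⁻¹ =
        g * (x * b * x⁻¹) * g⁻¹ by group, h1, hng b hb]
      group
  obtain ⟨h₃, hh₃, hh₃'⟩ := hnorm (conjSubgroup g P) (conjSubgroup n Y) hgS
    (by
      rw [hfix]
      exact conjSubgroup_le.2 fun y hy => conj_mem_divPart (hT.comm_of_le fixedIn_le) le_rfl y
        (hYJ hy))
    (by
      rintro _ ⟨x, hx, rfl⟩ _ ⟨y, hy, rfl⟩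
      exact ⟨_, hPY x hx y hy, (hact x hx y hy).symm⟩)
    (by
      refine le_trans ?_ hk
      rw [← Set.ncard_image_of_injective ((Y : Set G) \ P) (MulAut.conj n).injective]
      refine Set.ncard_le_ncard ?_ ((Set.toFinite _).sdiff.image _)
      rintro _ ⟨⟨y, hy, rfl⟩, hyP⟩
      refine ⟨y, ⟨hy, fun hyP' => hyP ?_⟩, rfl⟩
      -- By rigidity `g` and `n` agree on `Y ∩ P`, so the measure of the induction does not grow.
      have := hT.conj_eq_of_mem_divPart hG hsat hBT hn hng (hYJ hy) (hg y hyP')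
      exact ⟨y, hyP', this⟩)
    (h * g⁻¹) (by rwa [hcj]) (by rwa [hcj]) (ν * n⁻¹)
    (Subgroup.mul_mem _ hν (Subgroup.inv_mem _ hn))
    (by
      rw [hpow]
      rintro _ ⟨b, hb, rfl⟩
      change (h * g⁻¹) * (n * b * n⁻¹) * (h * g⁻¹)⁻¹ = (ν * n⁻¹) * (n * b * n⁻¹) * (ν * n⁻¹)⁻¹
      rw [← conj_mul_conj (ν * n⁻¹), inv_mul_cancel_right, hνh b hb, ← hng b hb,
        ← conj_mul_conj, inv_mul_cancel_right])
  refine ⟨h₃⁻¹ * h₂, fun x hx => conj_eq_of_conj_eq ?_, fun y hy => conj_eq_of_conj_eq ?_⟩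
  · rw [hh₂ x hx, hh₃ _ (conj_mem_conjSubgroup hx), ← conj_mul_conj, inv_mul_cancel_right]
  · rw [hh₂' y hy, hh₃' _ (conj_mem_conjSubgroup hy), ← conj_mul_conj, inv_mul_cancel_right]

end

/-- An abelian `p`-group with finite `p`-torsion is the product of a `p`-divisible subgroup and
a group of finite exponent. -/
lemma exists_divisible_mul_torsion {A : Type*} [CommGroup A] {p : ℕ}
    (htors : ∀ a : A, ∃ k : ℕ, a ^ p ^ k = 1) (hfin : {a : A | a ^ p = 1}.Finite) :
    ∃ (k : ℕ) (D : Subgroup A), (∀ d ∈ D, ∃ e ∈ D, e ^ p = d) ∧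
      ∀ x, ∃ e, e ^ p ^ k = 1 ∧ ∃ d ∈ D, x = e * d := by
  -- The elements of order dividing `p` that have a `p ^ k`-th root form a decreasing chain of
  -- finite sets, which is constant from some `k₀` on.
  let F : ℕ → Set A := fun k => {a | a ^ p = 1 ∧ ∃ u, u ^ p ^ k = a}
  have hFfin : ∀ k, (F k).Finite := fun k => hfin.subset fun a ha => ha.1
  obtain ⟨k₀, hk₀⟩ : ∃ k₀, ∀ k, (F k₀).ncard ≤ (F k).ncard :=
    ⟨Function.argmin fun k => (F k).ncard, fun k => Function.argmin_le (fun k => (F k).ncard) k⟩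
  have hF : ∀ k, k₀ ≤ k → F k₀ ⊆ F k := by
    intro k hk
    refine (Set.eq_of_subset_of_ncard_le ?_ (hk₀ k) (hFfin k₀)).ge
    rintro a ⟨ha, u, rfl⟩
    refine ⟨ha, u ^ p ^ (k - k₀), ?_⟩
    rw [← pow_mul, ← pow_add, Nat.sub_add_cancel hk]
  have key : ∀ j : ℕ, ∀ u : A, (u ^ p ^ k₀) ^ p ^ j = 1 → ∀ k, k₀ ≤ k →
      ∃ v, v ^ p ^ k = u ^ p ^ k₀ := by
    intro j
    induction j with
    | zero => exact fun u hu k _ => ⟨1, by rw [one_pow]; simpa using hu.symm⟩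
    | succ j ih =>
      intro u hu k hk
      obtain ⟨z, hz⟩ := ih (u ^ p) (by
        rw [← hu, ← pow_mul, ← pow_mul, ← pow_mul]; congr 1; ring) (k + 1) (by omega)
      -- `z` is a root of the `p`-th power of `u ^ p ^ k₀`. The error is killed by `p` and is a `p ^
      -- k₀`-th power, so it too has a `p ^ k`-th root.
      have hmem : u ^ p ^ k₀ * (z ^ p ^ k)⁻¹ ∈ F k₀ := by
        constructor
        · rw [mul_pow, inv_pow, ← pow_mul z, ← pow_succ, hz, mul_inv_eq_one, ← pow_mul,
            ← pow_mul, mul_comm]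
        · refine ⟨u * (z ^ p ^ (k - k₀))⁻¹, ?_⟩
          rw [mul_pow, inv_pow, ← pow_mul, ← pow_add, Nat.sub_add_cancel hk]
      obtain ⟨-, v, hv⟩ := hF k hk hmem
      exact ⟨v * z, by rw [mul_pow, hv, inv_mul_cancel_right]⟩
  have hall : ∀ u : A, ∀ k, k₀ ≤ k → ∃ v, v ^ p ^ k = u ^ p ^ k₀ := fun u =>
    (htors (u ^ p ^ k₀)).elim fun j hj => key j u hj
  refine ⟨k₀, (powMonoidHom (p ^ k₀)).range, ?_, fun x => ?_⟩
  · rintro _ ⟨u, rfl⟩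
    obtain ⟨v, hv⟩ := hall u (k₀ + 1) (by omega)
    exact ⟨_, ⟨v, rfl⟩, by rw [powMonoidHom_apply, ← pow_mul, ← pow_succ]; exact hv⟩
  · obtain ⟨v, hv⟩ := hall x (k₀ + k₀) (by omega)
    refine ⟨x * (v ^ p ^ k₀)⁻¹, ?_, _, ⟨v, rfl⟩, by simp⟩
    rw [mul_pow, inv_pow, ← pow_mul, ← pow_add, hv, mul_inv_cancel]

lemma countable_closure {G : Type*} [Group G] {s : Set G} (hs : s.Countable) :
    Countable (Subgroup.closure s) := by
  have := hs.to_subtype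
  have : Countable (FreeGroup s) := Quot.mk_surjective.countable
  have h : (FreeGroup.lift (Subtype.val : s → G)).range = Subgroup.closure s := by
    rw [FreeGroup.range_lift_eq_closure, Subtype.range_coe]
  rw [← h]
  exact (FreeGroup.lift _).rangeRestrict_surjective.countable

/-! ### Generation by finite data, and part (a). -/

section

variable {G : Type*} [Group G] {p m : ℕ} {T S : Subgroup G}

lemma IsTorusIn.exists_eq_mul_divPart (hT : IsTorusIn p m T S) {X : Subgroup G} (hX : X ≤ T) :
    ∃ k : ℕ, ∀ x ∈ X, ∃ e ∈ X, e ^ p ^ k = 1 ∧ ∃ d ∈ divPart p X, x = e * d := by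
  let _ : CommGroup X :=
    { (inferInstance : Group X) with
      mul_comm := fun a b => Subtype.ext (hT.comm a (hX a.2) b (hX b.2)) }
  obtain ⟨k, D, hD, h⟩ := exists_divisible_mul_torsion (A := X) (p := p)
    (fun a => (hT.tors a (hX a.2)).imp fun k hk => Subtype.ext hk)
    (Set.Finite.of_finite_image (f := Subtype.val) ((hT.finite_tors 1).subset (by
      rintro _ ⟨a, ha, rfl⟩
      exact ⟨hX a.2, by rw [pow_one]; exact congrArg Subtype.val ha⟩))
      Subtype.val_injective.injOn)
  refine ⟨k, fun x hx => ?_⟩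
  obtain ⟨e, he, d, hd, hxe⟩ := h ⟨x, hx⟩
  refine ⟨e, e.2, congrArg Subtype.val he, d, ?_, congrArg Subtype.val hxe⟩
  refine le_divPart (D := D.map X.subtype) (Subgroup.map_subtype_le D) ?_ ⟨d, hd, rfl⟩
  rintro _ ⟨d, hd, rfl⟩
  obtain ⟨e, he, rfl⟩ := hD d hd
  exact ⟨e, ⟨e, he, rfl⟩, rfl⟩

variable [Fact p.Prime]

lemma IsTorusIn.fullyNormalized (hT : IsTorusIn p m T S) :
    (fusionSystemOf ⊤ S le_top).FullyNormalized p T := by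
  intro R hR
  obtain ⟨g, -, rfl, hg⟩ := (mem_conjClass_fusionSystemOf hT.le).1 hR
  have hN := Subgroup.mem_normalizer_iff.1 (hT.mem_normalizer (conjSubgroup_le.1 hg))
  have : conjSubgroup g T = T := by
    refine le_antisymm (conjSubgroup_le.2 fun t => (hN t).1) fun t ht => ?_
    have h : g * (g⁻¹ * t * g) * g⁻¹ = t := by group
    exact ⟨g⁻¹ * t * g, (hN _).2 (h.symm ▸ ht), h⟩
  rw [this]

/-- Saturation makes `Out_F(T)` finite, and `Inn(T)` is trivial because `T` is abelian. -/
lemma IsTorusIn.finite_aut (hT : IsTorusIn p m T S)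
    (hsat : (fusionSystemOf ⊤ S le_top).IsSaturated p) :
    Finite ((fusionSystemOf ⊤ S le_top).aut T hT.le) := by
  have hfin := (hsat.sylow_axiom T hT.le hT.fullyNormalized).1.1
  refine Finite.of_injective (QuotientGroup.mk : _ → FusionSystem.Out _ T hT.le) fun α β h => ?_
  obtain ⟨t, ht⟩ := Subgroup.mem_subgroupOf.1 (QuotientGroup.eq.1 h)
  have h1 : MulAut.conj t = 1 := by
    ext x
    exact mul_inv_eq_iff_eq_mul.2 (hT.comm t t.2 x x.2)
  have h2 : (α⁻¹ * β : MulAut T) = 1 := by rw [← h1]; exact ht.symm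
  exact Subtype.ext (inv_mul_eq_one.1 h2)

/-- Every subgroup `P ≤ S` is generated by a finite subgroup `P₀` and elements of
`divPart p (fixedIn T B)`, where `B` is generated by the `p ^ m`-th powers of elements of `P₀`. -/
lemma IsTorusIn.exists_finite_le (hG : IsLocallyFiniteGroup G) (hT : IsTorusIn p m T S)
    (hsat : (fusionSystemOf ⊤ S le_top).IsSaturated p) {P : Subgroup G} (hP : P ≤ S) :
    ∃ P₀ ≤ P, Finite P₀ ∧ ∀ x ∈ P, ∃ a ∈ P₀, ∃ d ∈ P,
      d ∈ divPart p (fixedIn T (powSubgroup (p ^ m) P₀)) ∧ x = a * d := by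
  have hrel : (T.subgroupOf P).FiniteIndex :=
    ⟨fun h => hT.relIndex (Subgroup.relIndex_eq_zero_of_le_right hP h)⟩
  obtain ⟨k, hk⟩ := hT.exists_eq_mul_divPart (X := P ⊓ T) inf_le_right
  have := hT.finite_aut hsat
  let W := (fusionSystemOf ⊤ S le_top).aut T hT.le
  -- For each of the finitely many `w` in `Aut_F(T)`, a witness `x` in `P` whose `p ^ m`-th power is
  -- moved by `w`, if there is one. Adjoining these to `P₀` ensures that its powers have the same
  -- pointwise stabilizer as those of `P`.
  have hW : ∀ w : W, ∃ x, ∃ hx : x ∈ P, ∀ y (hy : y ∈ P),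
      w.1 ⟨x ^ p ^ m, hT.pow_mem x (hP hx)⟩ = ⟨x ^ p ^ m, hT.pow_mem x (hP hx)⟩ →
        w.1 ⟨y ^ p ^ m, hT.pow_mem y (hP hy)⟩ = ⟨y ^ p ^ m, hT.pow_mem y (hP hy)⟩ := by
    intro w
    by_cases h : ∃ x, ∃ hx : x ∈ P, w.1 ⟨x ^ p ^ m, hT.pow_mem x (hP hx)⟩ ≠
        ⟨x ^ p ^ m, hT.pow_mem x (hP hx)⟩
    · obtain ⟨x, hx, hxw⟩ := h
      exact ⟨x, hx, fun _ _ h => absurd h hxw⟩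
    · push Not at h
      exact ⟨1, P.one_mem, fun y hy _ => h y hy⟩
  choose f hfP hf using hW
  let E : Set G := Set.range (fun q : P ⧸ T.subgroupOf P => (q.out : G)) ∪
    {a | a ∈ P ∧ a ∈ T ∧ a ^ p ^ k = 1} ∪ Set.range f
  have hE : E.Finite := ((Set.finite_range _).union
    ((hT.finite_tors k).subset fun a ha => ha.2)).union (Set.finite_range _)
  let P₀ := Subgroup.closure E
  have hP₀ : P₀ ≤ P := by
    refine (Subgroup.closure_le _).2 (Set.union_subset (Set.union_subset ?_ ?_) ?_)
    · rintro _ ⟨q, rfl⟩; exact (q.out).2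
    · exact fun a ha => ha.1
    · rintro _ ⟨w, rfl⟩; exact hfP w
  refine ⟨P₀, hP₀, hG P₀ ((Subgroup.fg_iff _).2 ⟨E, rfl, hE⟩), fun x hx => ?_⟩
  obtain ⟨⟨u, hu⟩, hxu⟩ := QuotientGroup.mk_out_eq_mul (T.subgroupOf P) ⟨x, hx⟩
  have hxu' := congrArg Subtype.val hxu
  obtain ⟨e, he, hek, d, hd, hud⟩ := hk (u⁻¹ : G)
    ⟨P.inv_mem u.2, T.inv_mem (Subgroup.mem_subgroupOf.1 hu)⟩
  refine ⟨((QuotientGroup.mk ⟨x, hx⟩ : P ⧸ T.subgroupOf P).out : G) * e, P₀.mul_mem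
    (Subgroup.subset_closure (Or.inl (Or.inl ⟨_, rfl⟩)))
    (Subgroup.subset_closure (Or.inl (Or.inr ⟨he.1, he.2, hek⟩))), d, (divPart_le hd).1, ?_, ?_⟩
  · refine divPart_mono (X := fixedIn T (powSubgroup (p ^ m) P)) ?_ ?_
    · refine fixedIn_anti_of fun n hn hb => ?_
      let w : MulAut T := MulDistribMulAction.toMulAut (Subgroup.normalizer (T : Set G)) T ⟨n, hn⟩
      have hw : ∀ t : T, (w t : G) = n * t * n⁻¹ := fun t => rfl
      have hwF : w ∈ W := ⟨hT.le, hT.le, n, trivial, hw⟩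
      have hle : powSubgroup (p ^ m) P ≤ Subgroup.centralizer {n} := by
        refine Fusion.powSubgroup_le.2 fun y hy => ?_
        have h1 := hf ⟨w, hwF⟩ y hy (Subtype.ext (hb _ (pow_mem_powSubgroup
          (Subgroup.subset_closure (Or.inr ⟨_, rfl⟩)))))
        rw [Subgroup.mem_centralizer_singleton_iff]
        have h2 : n * y ^ p ^ m * n⁻¹ = y ^ p ^ m := congrArg Subtype.val h1
        exact (mul_inv_eq_iff_eq_mul.1 h2).symm
      intro b hb'
      have := Subgroup.mem_centralizer_singleton_iff.1 (hle hb')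
      rw [← this, mul_inv_cancel_right]
    -- Elements of the divisible part of `P ⊓ T` are themselves `p ^ m`-th powers of elements of
    -- `P`.
    · have hdiv := exists_pow_eq_of_mem_divPart (p := p)
        (hT.comm_of_le (inf_le_right : P ⊓ T ≤ T))
      refine le_divPart (fun y hy => ?_) hdiv hd
      obtain ⟨z, hz, rfl⟩ := exists_pow_prime_pow_eq hdiv m y hy
      exact le_fixedIn (hT.powSubgroup_le hP) (pow_mem_powSubgroup (divPart_le hz).1)
  · rw [hxu', mul_assoc, ← hud]
    simp

/-- Compatible conjugations glue to a homomorphism on the union. Each finite subgroup lies in some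
`R k`, so the continuity axiom applies. -/
lemma exists_conj_eq_of_directed
    (hsat : (fusionSystemOf ⊤ S le_top).IsSaturated p) {R : ℕ → Subgroup G} (hR : Monotone R)
    (hRS : ∀ k, R k ≤ S) {g : ℕ → G} (hg : ∀ k, ∀ x ∈ R k, g k * x * (g k)⁻¹ ∈ S)
    (hcompat : ∀ k l, k ≤ l → ∀ x ∈ R k, g l * x * (g l)⁻¹ = g k * x * (g k)⁻¹) :
    ∃ g', ∀ k, ∀ x ∈ R k, g' * x * g'⁻¹ = g k * x * (g k)⁻¹ := by
  have hmem : ∀ x : (⨆ k, R k : Subgroup G), ∃ k, (x : G) ∈ R k := fun x =>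
    (Subgroup.mem_iSup_of_directed hR.directed_le).1 x.2
  choose j hj using hmem
  have heq : ∀ (x : (⨆ k, R k : Subgroup G)) (k : ℕ), (x : G) ∈ R k →
      g (j x) * x * (g (j x))⁻¹ = g k * x * (g k)⁻¹ := by
    intro x k hk
    rcases le_total (j x) k with h | h
    · exact (hcompat _ _ h _ (hj x)).symm
    · exact hcompat _ _ h _ hk
  let φ : (⨆ k, R k : Subgroup G) →* S := MonoidHom.mk'
    (fun x => ⟨g (j x) * x * (g (j x))⁻¹, hg _ _ (hj x)⟩) fun x y => by
      apply Subtype.ext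
      have hx := hR (le_max_left (j x) (j y)) (hj x)
      have hy := hR (le_max_right (j x) (j y)) (hj y)
      change g (j (x * y)) * (x * y : G) * (g (j (x * y)))⁻¹ =
        g (j x) * x * (g (j x))⁻¹ * (g (j y) * y * (g (j y))⁻¹)
      have hxy := heq (x * y) _ ((R _).mul_mem hx hy)
      rw [Subgroup.coe_mul] at hxy
      rw [hxy, heq x _ hx, heq y _ hy]
      group
  have hφ : ∀ (x : (⨆ k, R k : Subgroup G)) (k : ℕ), (x : G) ∈ R k →
      (φ x : G) = g k * x * (g k)⁻¹ := heq
  have hφinj : Function.Injective φ := by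
    rw [injective_iff_map_eq_one]
    intro x hx
    have h1 : g (j x) * x * (g (j x))⁻¹ = 1 := congrArg Subtype.val hx
    exact Subtype.ext (by simpa using h1)
  have hle : (⨆ k, R k) ≤ S := iSup_le hRS
  obtain ⟨-, -, g', -, hg'⟩ := hsat.continuity_axiom _ hle φ hφinj (by
    intro Q hQ _
    obtain ⟨k, hk⟩ : ∃ k, Q ≤ R k := by
      choose i hi using fun x : Q => (Subgroup.mem_iSup_of_directed hR.directed_le).1 (hQ x.2)
      obtain ⟨M, hM⟩ := (Set.finite_range i).bddAbove
      exact ⟨M, fun x hx => hR (hM ⟨⟨x, hx⟩, rfl⟩) (hi ⟨x, hx⟩)⟩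
    exact ⟨hQ.trans hle, le_rfl, g k, trivial, fun x => hφ (Subgroup.inclusion hQ x) k (hk x.2)⟩)
  refine ⟨g', fun k x hx => ?_⟩
  have hx' := Subgroup.mem_iSup_of_mem k hx
  rw [← hφ ⟨x, hx'⟩ k hx, hg']

/-- A morphism defined on a finite subgroup `P` extends to `divPart p (fixedIn T B)`, where `B` is
generated by the `p ^ m`-th powers of elements of `P`. -/
lemma IsTorusIn.exists_extension_to_divPart (hG : IsLocallyFiniteGroup G)
    (hT : IsTorusIn p m T S) (hsat : (fusionSystemOf ⊤ S le_top).IsSaturated p) {P : Subgroup G}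
    [Finite P] (hP : P ≤ S) {g : G} (hg : ∀ x ∈ P, g * x * g⁻¹ ∈ S) :
    ∃ g', (∀ x ∈ P, g' * x * g'⁻¹ = g * x * g⁻¹) ∧
      ∀ y ∈ divPart p (fixedIn T (powSubgroup (p ^ m) P)), g' * y * g'⁻¹ ∈ S := by
  set J := divPart p (fixedIn T (powSubgroup (p ^ m) P)) with hJ
  have hJT : J ≤ T := divPart_le.trans fixedIn_le
  have hJcomm := hT.comm_of_le hJT
  have hBfin : Finite (powSubgroup (p ^ m) P) := Finite.of_injective _
    (Subgroup.inclusion_injective (powSubgroup_le_self : _ ≤ P))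
  obtain ⟨n, hn, hng⟩ := hT.exists_normalizer_conj_eq hsat (hT.powSubgroup_le hP) (g := g)
    (fun b hb => hT.powSubgroup_le (conjSubgroup_le.2 hg) (by
      rw [powSubgroup_conjSubgroup]; exact conj_mem_conjSubgroup hb))
  have hnT := fun t => (Subgroup.mem_normalizer_iff.1 hn t).1
  -- The `p ^ k`-torsion of `J` is finite, normalized by `P`, and exhausts `J`. The extensions over
  -- these groups all agree with `n` there, so they are compatible.
  let Y : ℕ → Subgroup G := fun k =>
    { carrier := {y | y ∈ J ∧ y ^ p ^ k = 1}
      one_mem' := ⟨J.one_mem, one_pow _⟩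
      mul_mem' := fun {a b} ha hb => ⟨J.mul_mem ha.1 hb.1, by
        rw [(show Commute a b from hJcomm a ha.1 b hb.1).mul_pow, ha.2, hb.2, one_mul]⟩
      inv_mem' := fun {a} ha => ⟨J.inv_mem ha.1, by rw [inv_pow, ha.2, inv_one]⟩ }
  have hYfin : ∀ k, Finite (Y k) := fun k =>
    ((hT.finite_tors k).subset fun y hy => ⟨hJT hy.1, hy.2⟩ : ((Y k : Set G)).Finite)
  have hYmono : Monotone Y := fun k l hkl y hy => ⟨hy.1, by
    rw [← Nat.add_sub_cancel' hkl, pow_add, pow_mul, hy.2, one_pow]⟩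
  have hPY : ∀ k, ∀ x ∈ P, ∀ y ∈ Y k, x * y * x⁻¹ ∈ Y k := fun k x hx y hy =>
    ⟨conj_mem_divPart (hT.comm_of_le fixedIn_le) (conjSubgroup_le.2 fun i hi =>
      hT.conj_mem_fixedIn_powSubgroup hP hx hi) y hy.1, by
      rw [conj_pow_eq, hy.2, mul_one, mul_inv_cancel]⟩
  choose f hf hf' using fun k => hT.exists_common_extension hG hsat _ P (Y k) hP
    (fun y hy => hy.1) (hPY k) le_rfl g hg n hn fun b hb => (hng b hb).symm
  obtain ⟨g', hg'⟩ := exists_conj_eq_of_directed hsat (R := fun k => P ⊔ Y k) (g := f)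
    (fun k l hkl => sup_le_sup_left (hYmono hkl) _)
    (fun k => sup_le hP fun y hy => hT.le (hJT hy.1))
    (fun k z hz => by
      obtain ⟨x, hx, y, hy, rfl⟩ := exists_eq_mul_of_mem_sup (hPY k) hz
      rw [show f k * (x * y) * (f k)⁻¹ = (f k * x * (f k)⁻¹) * (f k * y * (f k)⁻¹) by group,
        hf k x hx, hf' k y hy]
      exact S.mul_mem (hg x hx) (hT.le (hnT y (hJT hy.1))))
    (fun k l hkl z hz => by
      obtain ⟨x, hx, y, hy, rfl⟩ := exists_eq_mul_of_mem_sup (hPY k) hz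
      have h : ∀ i, f i * (x * y) * (f i)⁻¹ = (f i * x * (f i)⁻¹) * (f i * y * (f i)⁻¹) :=
        fun i => by group
      rw [h, h, hf k x hx, hf l x hx, hf' k y hy, hf' l y (hYmono hkl hy)])
  refine ⟨g', fun x hx => ?_, fun y hy => ?_⟩
  · rw [hg' 0 x ((le_sup_left : P ≤ P ⊔ Y 0) hx), hf 0 x hx]
  · obtain ⟨k, hk⟩ := hT.tors y (hJT hy)
    rw [hg' k y ((le_sup_right : Y k ≤ P ⊔ Y k) ⟨hy, hk⟩), hf' k y ⟨hy, hk⟩]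
    exact hT.le (hnT y (hJT hy))

/-- The fusion system of `G` is realized by a countable subgroup. -/
theorem IsTorusIn.exists_countable (hG : IsLocallyFiniteGroup G) (hT : IsTorusIn p m T S)
    (hS : Countable S) (hsat : (fusionSystemOf ⊤ S le_top).IsSaturated p) :
    ∃ K : Subgroup G, Countable K ∧ ∃ hSK : S ≤ K,
      fusionSystemOf ⊤ S le_top = fusionSystemOf K S hSK := by
  classical
  -- An index is a finite subset of `S` with a finite set of pairs prescribing values on it. `good`
  -- asks that `κ` take such values and, when the subset is a subgroup `P`, that `κ` carry the
  -- associated `J` into `S`.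
  let good : Finset S × Finset (S × S) → G → Prop := fun i κ =>
    (∀ a ∈ i.1, ∃ q ∈ i.2, q.1 = a ∧ (q.2 : G) = κ * a * κ⁻¹) ∧
      ∀ P : Subgroup G, (∀ x, x ∈ P ↔ ∃ a ∈ i.1, (a : G) = x) →
        ∀ y ∈ divPart p (fixedIn T (powSubgroup (p ^ m) P)), κ * y * κ⁻¹ ∈ S
  let c : Finset S × Finset (S × S) → G := fun i => if h : ∃ κ, good i κ then h.choose else 1
  have hc : ∀ i κ, good i κ → good i (c i) := fun i κ h => by
    have h' : ∃ κ, good i κ := ⟨κ, h⟩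
    simp only [c, dif_pos h']
    exact h'.choose_spec
  let K := Subgroup.closure ((S : Set G) ∪ Set.range c)
  have hSK : S ≤ K := fun s hs => Subgroup.subset_closure (Or.inl hs)
  have hK : Countable K := countable_closure
    ((Set.countable_coe_iff.1 hS).union (Set.countable_range c))
  refine ⟨K, hK, hSK, ?_⟩
  have key : ∀ (P : Subgroup G), P ≤ S → ∀ g : G, (∀ x ∈ P, g * x * g⁻¹ ∈ S) →
      ∃ κ ∈ K, ∀ x ∈ P, κ * x * κ⁻¹ = g * x * g⁻¹ := by
    intro P hP g hg
    obtain ⟨P₀, hP₀, hfin, hgen⟩ := hT.exists_finite_le hG hsat hP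
    have hP₀S := hP₀.trans hP
    obtain ⟨g', hg', hg'J⟩ := hT.exists_extension_to_divPart hG hsat hP₀S
      (fun x hx => hg x (hP₀ hx))
    let A : Finset S := (Set.finite_range fun x : P₀ => (⟨x, hP₀S x.2⟩ : S)).toFinset
    let Γ : Finset (S × S) := (Set.finite_range fun x : P₀ =>
      ((⟨x, hP₀S x.2⟩, ⟨g * x * g⁻¹, hg x (hP₀ x.2)⟩) : S × S)).toFinset
    have hA : ∀ x, x ∈ P₀ ↔ ∃ a ∈ A, (a : G) = x := by
      intro x
      constructor
      · exact fun hx => ⟨⟨x, hP₀S hx⟩, (Set.Finite.mem_toFinset _).2 ⟨⟨x, hx⟩, rfl⟩, rfl⟩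
      · rintro ⟨a, ha, rfl⟩
        obtain ⟨y, rfl⟩ := (Set.Finite.mem_toFinset _).1 ha
        exact y.2
    have hgood : good (A, Γ) g' := by
      refine ⟨fun a ha => ?_, fun P hPA => ?_⟩
      · have haP : (a : G) ∈ P₀ := (hA a).2 ⟨a, ha, rfl⟩
        exact ⟨_, (Set.Finite.mem_toFinset _).2 ⟨⟨a, haP⟩, rfl⟩, rfl, (hg' a haP).symm⟩
      · have : P = P₀ := by
          ext x
          rw [hPA, hA]
        rw [this]
        exact hg'J
    obtain ⟨h1, h2⟩ := hc _ _ hgood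
    have h2 := h2 P₀ hA
    set κ := c (A, Γ)
    have h1' : ∀ x ∈ P₀, κ * x * κ⁻¹ = g * x * g⁻¹ := by
      intro x hx
      obtain ⟨a, ha, rfl⟩ := (hA x).1 hx
      obtain ⟨q, hq, hqa, hqκ⟩ := h1 a ha
      obtain ⟨y, rfl⟩ := (Set.Finite.mem_toFinset _).1 hq
      rw [← hqκ, ← hqa]
    have hBfin : Finite (powSubgroup (p ^ m) P₀) := Finite.of_injective _
      (Subgroup.inclusion_injective (powSubgroup_le_self : _ ≤ P₀))
    have hBT := hT.powSubgroup_le hP₀S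
    obtain ⟨n, hn, hng⟩ := hT.exists_normalizer_conj_eq hsat hBT (g := g)
      (fun b hb => hT.powSubgroup_le (conjSubgroup_le.2 fun x hx => hg x (hP₀ hx)) (by
        rw [powSubgroup_conjSubgroup]; exact conj_mem_conjSubgroup hb))
    refine ⟨κ, Subgroup.subset_closure (Or.inr ⟨_, rfl⟩), fun x hx => ?_⟩
    -- `κ` and `g` agree on `P₀`. Both send `d` into `S`, so by rigidity both act on it as `n`.
    obtain ⟨a, ha, d, hd, hdJ, rfl⟩ := hgen x hx
    have h : ∀ i : G, i * (a * d) * i⁻¹ = (i * a * i⁻¹) * (i * d * i⁻¹) := fun i => by group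
    rw [h, h, h1' a ha,
      hT.conj_eq_of_mem_divPart hG hsat hBT hn (fun b hb => (hng b hb).symm) hdJ (hg d hd),
      hT.conj_eq_of_mem_divPart hG hsat hBT hn
        (fun b hb => (h1' b (powSubgroup_le_self hb)).trans (hng b hb).symm) hdJ (h2 d hdJ)]
  ext P Q φ
  constructor
  · rintro ⟨hP, hQ, g, -, hg⟩
    obtain ⟨κ, hκ, h⟩ := key P hP g fun x hx => (hg ⟨x, hx⟩) ▸ hQ (φ ⟨x, hx⟩).2
    exact ⟨hP, hQ, κ, hκ, fun x => (hg x).trans (h x x.2).symm⟩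
  · rintro ⟨hP, hQ, g, -, hg⟩
    exact ⟨hP, hQ, g, trivial, hg⟩

end

/-! ### Sylow subgroups and saturation for finite groups. -/

section

variable {p : ℕ}

lemma isSylow_of_sylow [Fact p.Prime] {A : Type*} [Group A] [Finite A] (Q : Sylow p A) :
    IsSylow p (Q : Subgroup A) := by
  refine ⟨Q.2, fun P hP => ?_⟩
  obtain ⟨Q', hQ'⟩ := hP.exists_le_sylow
  obtain ⟨g, rfl⟩ := MulAction.exists_smul_eq A Q' Q
  exact ⟨g, fun x hx => Subgroup.smul_mem_pointwise_smul x (MulAut.conj g) _ (hQ' hx)⟩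

variable {G : Type*} [Group G]

lemma IsSylow.exists_conjSubgroup_le {Y P : Subgroup G} (hY : IsSylow p Y) (hP : IsPGroup p P) :
    ∃ g, conjSubgroup g P ≤ Y :=
  (hY.2 P hP).imp fun _ h => conjSubgroup_le.2 h

lemma IsSylow.map [Fact p.Prime] {A B : Type*} [Group A] [Finite A] [Group B] {Y : Subgroup A}
    (hY : IsSylow p Y) {f : A →* B} (hf : Function.Surjective f) : IsSylow p (Y.map f) := by
  obtain ⟨Q, hQ⟩ := hY.1.exists_le_sylow
  have hYQ : Y = Q := by
    obtain ⟨g, hg⟩ := hY.exists_conjSubgroup_le Q.2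
    refine Subgroup.eq_of_le_of_card_ge hQ ?_
    rw [← card_conjSubgroup g Q.1]
    exact Subgroup.card_le_of_le hg
  have : Finite B := Finite.of_surjective f hf
  rw [hYQ]
  exact isSylow_of_sylow (Q.mapSurjective hf)

/-- `R` is a Sylow `p`-subgroup of the subgroup `H`. -/
structure IsSylowIn (p : ℕ) (R H : Subgroup G) : Prop where
  le : R ≤ H
  isPGroup : IsPGroup p R
  conj : ∀ A ≤ H, IsPGroup p A → ∃ h ∈ H, conjSubgroup h A ≤ R

lemma isSylowIn_iff {R H : Subgroup G} (hle : R ≤ H) :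
    IsSylowIn p R H ↔ IsSylow p (R.subgroupOf H) := by
  constructor
  · intro h
    refine ⟨h.isPGroup.comap_subtype, fun P hP => ?_⟩
    obtain ⟨g, hg, h'⟩ := h.conj (P.map H.subtype) (Subgroup.map_subtype_le P) (hP.map _)
    exact ⟨⟨g, hg⟩, fun x hx => conjSubgroup_le.1 h' x ⟨x, hx, rfl⟩⟩
  · intro h
    refine ⟨hle, h.1.of_equiv (Subgroup.subgroupOfEquivOfLe hle), fun A hA hAp => ?_⟩
    obtain ⟨g, hg⟩ := h.2 (A.subgroupOf H) hAp.comap_subtype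
    exact ⟨g, g.2, conjSubgroup_le.2 fun x hx => hg ⟨x, hA hx⟩ hx⟩

lemma exists_isSylowIn_ge [Fact p.Prime] {A H : Subgroup G} [Finite H] (hA : A ≤ H)
    (hAp : IsPGroup p A) : ∃ R, A ≤ R ∧ IsSylowIn p R H := by
  obtain ⟨Q, hQ⟩ := (hAp.comap_subtype (K := H)).exists_le_sylow
  refine ⟨Q.1.map H.subtype, fun x hx => ⟨⟨x, hA hx⟩, hQ hx, rfl⟩, ?_⟩
  have h : (Q.1.map H.subtype).subgroupOf H = Q := by
    ext x
    simp [Subgroup.mem_subgroupOf]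
  rw [isSylowIn_iff (Subgroup.map_subtype_le _), h]
  exact isSylow_of_sylow Q

lemma IsSylowIn.card_le {R H A : Subgroup G} [Finite H] (hR : IsSylowIn p R H) (hA : A ≤ H)
    (hAp : IsPGroup p A) : Nat.card A ≤ Nat.card R := by
  obtain ⟨h, -, hh⟩ := hR.conj A hA hAp
  have : Finite R := Finite.of_injective _ (Subgroup.inclusion_injective hR.le)
  rw [← card_conjSubgroup h A]
  exact Subgroup.card_le_of_le hh

lemma IsSylowIn.eq_of_le {R H A : Subgroup G} [Finite H] (hR : IsSylowIn p R H) (hA : A ≤ H)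
    (hAp : IsPGroup p A) (hRA : R ≤ A) : R = A :=
  have : Finite A := Finite.of_injective _ (Subgroup.inclusion_injective hA)
  Subgroup.eq_of_le_of_card_ge hRA (hR.card_le hA hAp)

lemma isPGroup_conjSubgroup {A : Subgroup G} (hA : IsPGroup p A) (g : G) :
    IsPGroup p (conjSubgroup g A) := hA.map _

lemma mem_normalizer_conjSubgroup {P : Subgroup G} {g x : G}
    (hx : x ∈ Subgroup.normalizer (P : Set G)) :
    g * x * g⁻¹ ∈ Subgroup.normalizer (conjSubgroup g P : Set G) := by
  rw [Subgroup.mem_normalizer_iff] at hx ⊢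
  intro y
  obtain ⟨y, rfl⟩ : ∃ w, y = g * w * g⁻¹ := ⟨g⁻¹ * y * g, by group⟩
  rw [conj_mem_conjSubgroup_iff, show g * x * g⁻¹ * (g * y * g⁻¹) * (g * x * g⁻¹)⁻¹ =
    g * (x * y * x⁻¹) * g⁻¹ by group, conj_mem_conjSubgroup_iff]
  exact hx y

lemma mem_centralizer_conjSubgroup {P : Subgroup G} {g x : G}
    (hx : x ∈ Subgroup.centralizer (P : Set G)) :
    g * x * g⁻¹ ∈ Subgroup.centralizer (conjSubgroup g P : Set G) := by
  rw [Subgroup.mem_centralizer_iff] at hx ⊢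
  rintro _ ⟨y, hy, rfl⟩
  change g * y * g⁻¹ * (g * x * g⁻¹) = g * x * g⁻¹ * (g * y * g⁻¹)
  calc _ = g * (y * x) * g⁻¹ := by group
    _ = _ := by rw [hx y hy]; group

lemma toralOrder_le_toralOrder_iff [Fact p.Prime] {A B : Type*} [Group A] [Group B] [Finite A]
    [Finite B] : toralOrder p A ≤ toralOrder p B ↔ Nat.card A ≤ Nat.card B := by
  rw [toralOrder_of_finite, toralOrder_of_finite]
  simp [Prod.Lex.toLex_le_toLex]

variable [Fact p.Prime] {H S : Subgroup G} {hSH : S ≤ H}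

lemma finite_of_le {A B : Subgroup G} [Finite B] (h : A ≤ B) : Finite A :=
  Finite.of_injective _ (Subgroup.inclusion_injective h)

/-- A larger `p`-subgroup of the normalizer could be conjugated into `S`, giving a conjugate of `P`
with a larger normalizer in `S`. -/
lemma IsSylowIn.normalizerIn [Finite H] (hS : IsSylowIn p S H) {P : Subgroup G} (hP : P ≤ S)
    (hfn : (fusionSystemOf H S hSH).FullyNormalized p P) :
    IsSylowIn p (normalizerIn S P) (H ⊓ Subgroup.normalizer (P : Set G)) := by
  have hSfin : Finite S := finite_of_le hSH
  have hfin : ∀ R, Finite (Fusion.normalizerIn S R) :=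
    fun R => finite_of_le (inf_le_left : _ ≤ S)
  have hNfin : Finite (H ⊓ Subgroup.normalizer (P : Set G) : Subgroup G) :=
    finite_of_le (inf_le_left : _ ≤ H)
  obtain ⟨R, hR, hRs⟩ := exists_isSylowIn_ge (p := p) (A := Fusion.normalizerIn S P)
    (inf_le_inf_right (Subgroup.normalizer (P : Set G)) hSH) (hS.isPGroup.to_le inf_le_left)
  have hRfin : Finite R := finite_of_le hRs.le
  obtain ⟨h, hh, hhR⟩ := hS.conj R (hRs.le.trans inf_le_left) hRs.isPGroup
  have hPR : P ≤ R := (le_inf hP Subgroup.le_normalizer).trans hR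
  have h1 := hfn _ ((mem_conjClass_fusionSystemOf hP).2
    ⟨h, hh, rfl, (conjSubgroup_mono hPR).trans hhR⟩)
  rw [toralOrder_le_toralOrder_iff] at h1
  have h2 : conjSubgroup h R ≤ Fusion.normalizerIn S (conjSubgroup h P) :=
    le_inf hhR (conjSubgroup_le.2 fun x hx => mem_normalizer_conjSubgroup (hRs.le hx).2)
  have h3 := Subgroup.card_le_of_le h2
  rw [card_conjSubgroup] at h3
  rw [Subgroup.eq_of_le_of_card_ge hR (h3.trans h1)]
  exact hRs

lemma IsSylowIn.centralizerIn [Finite H] (hS : IsSylowIn p S H) {P : Subgroup G} (hP : P ≤ S)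
    (hfc : (fusionSystemOf H S hSH).FullyCentralized p P) :
    IsSylowIn p (centralizerIn S P) (H ⊓ Subgroup.centralizer (P : Set G)) := by
  have hSfin : Finite S := finite_of_le hSH
  have hfin : ∀ R, Finite (Fusion.centralizerIn S R) :=
    fun R => finite_of_le (inf_le_left : _ ≤ S)
  have hNfin : Finite (H ⊓ Subgroup.centralizer (P : Set G) : Subgroup G) :=
    finite_of_le (inf_le_left : _ ≤ H)
  obtain ⟨R, hR, hRs⟩ := exists_isSylowIn_ge (p := p) (A := Fusion.centralizerIn S P)
    (inf_le_inf_right (Subgroup.centralizer (P : Set G)) hSH) (hS.isPGroup.to_le inf_le_left)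
  have hRfin : Finite R := finite_of_le hRs.le
  -- `R ⊔ P` rather than `R` is moved into `S`, because `R` need not contain `P` and the conjugate
  -- of `P` must lie in `S`.
  obtain ⟨h, hh, hhR⟩ := hS.conj (R ⊔ P) (sup_le (hRs.le.trans inf_le_left) (hP.trans hSH))
    (hRs.isPGroup.to_sup_of_normal_right' (hS.isPGroup.to_le hP)
      (hRs.le.trans (inf_le_right.trans (Subgroup.centralizer_le_normalizer _))))
  have h1 := hfc _ ((mem_conjClass_fusionSystemOf hP).2
    ⟨h, hh, rfl, (conjSubgroup_mono le_sup_right).trans hhR⟩)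
  rw [toralOrder_le_toralOrder_iff] at h1
  have h2 : conjSubgroup h R ≤ Fusion.centralizerIn S (conjSubgroup h P) :=
    le_inf ((conjSubgroup_mono le_sup_left).trans hhR)
      (conjSubgroup_le.2 fun x hx => mem_centralizer_conjSubgroup (hRs.le hx).2)
  have h3 := Subgroup.card_le_of_le h2
  rw [card_conjSubgroup] at h3
  rw [Subgroup.eq_of_le_of_card_ge hR (h3.trans h1)]
  exact hRs

/-- The centralizer of a conjugate is brought back to centralize `P`, then moved into `N_S(P)` by an
element normalizing `P`; it still centralizes `P`. -/
lemma IsSylowIn.fullyCentralized [Finite H] (hS : IsSylowIn p S H) {P : Subgroup G} (hP : P ≤ S)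
    (hfn : (fusionSystemOf H S hSH).FullyNormalized p P) :
    (fusionSystemOf H S hSH).FullyCentralized p P := by
  have hSfin : Finite S := finite_of_le hSH
  have hfin : ∀ R, Finite (Fusion.centralizerIn S R) :=
    fun R => finite_of_le (inf_le_left : _ ≤ S)
  intro R hR
  obtain ⟨g, hg, rfl, hRS⟩ := (mem_conjClass_fusionSystemOf hP).1 hR
  rw [toralOrder_le_toralOrder_iff]
  set A := conjSubgroup g⁻¹ (Fusion.centralizerIn S (conjSubgroup g P))
  have hAH : A ≤ H := conjSubgroup_le.2 fun x hx =>
    H.mul_mem (H.mul_mem (H.inv_mem hg) (hSH hx.1)) (H.inv_mem (H.inv_mem hg))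
  have hAC : A ≤ Subgroup.centralizer (P : Set G) := conjSubgroup_le.2 fun x hx => by
    have := mem_centralizer_conjSubgroup (g := g⁻¹) hx.2
    rwa [conjSubgroup_inv_conjSubgroup] at this
  have hAp : IsPGroup p A := isPGroup_conjSubgroup (hS.isPGroup.to_le inf_le_left) _
  obtain ⟨h, hh, hhA⟩ := (hS.normalizerIn hP hfn).conj A
    (le_inf hAH (hAC.trans (Subgroup.centralizer_le_normalizer _))) hAp
  have hhP : conjSubgroup h P = P := by
    have hN := Subgroup.mem_normalizer_iff.1 hh.2
    refine le_antisymm (conjSubgroup_le.2 fun x => (hN x).1) fun x hx => ?_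
    have h1 : h * (h⁻¹ * x * h) * h⁻¹ = x := by group
    exact ⟨h⁻¹ * x * h, (hN _).2 (h1.symm ▸ hx), h1⟩
  have hle : conjSubgroup h A ≤ Fusion.centralizerIn S P :=
    le_inf (hhA.trans inf_le_left) (conjSubgroup_le.2 fun x hx => by
      have := mem_centralizer_conjSubgroup (g := h) (hAC hx)
      rwa [hhP] at this)
  have := Subgroup.card_le_of_le hle
  rwa [card_conjSubgroup, card_conjSubgroup] at this

/-- `Out_F(P)` is a quotient of `N_H(P)`, and `Out_S(P)` is the image of its Sylow subgroup
`N_S(P)`. -/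
lemma IsSylowIn.fullyAutomized [Finite H] (hS : IsSylowIn p S H) {P : Subgroup G} (hP : P ≤ S)
    (hfn : (fusionSystemOf H S hSH).FullyNormalized p P) :
    (fusionSystemOf H S hSH).FullyAutomized p P hP := by
  have hPfin : Finite P := finite_of_le (hP.trans hSH)
  have hMfin : Finite (MulAut P) := Finite.of_injective (fun α : MulAut P => (α : P → P))
    DFunLike.coe_injective
  refine ⟨inferInstance, ?_⟩
  set N := H ⊓ Subgroup.normalizer (P : Set G) with hN
  have hNfin : Finite N := finite_of_le (inf_le_left : _ ≤ H)
  let ρ : N →* (fusionSystemOf H S hSH).aut P hP :=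
    (P.normalizerMonoidHom.comp (Subgroup.inclusion inf_le_right)).codRestrict _ fun x =>
      ⟨hP, hP, x, x.2.1, fun _ => rfl⟩
  have hρ : ∀ (x : N) (y : P), ((ρ x).1 y : G) = x * y * (x : G)⁻¹ := fun _ _ => rfl
  let π := QuotientGroup.mk' ((inn P).subgroupOf ((fusionSystemOf H S hSH).aut P hP))
  have hsurj : Function.Surjective (π.comp ρ) := by
    refine (QuotientGroup.mk'_surjective _).comp ?_
    rintro ⟨α, -, -, g, hg, hα⟩
    refine ⟨⟨g, hg, Subgroup.mem_normalizer_iff.2 fun x => ⟨fun hx => ?_, fun hx => ?_⟩⟩, ?_⟩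
    · exact hα ⟨x, hx⟩ ▸ (α ⟨x, hx⟩).2
    · obtain ⟨y, hy⟩ := α.surjective ⟨_, hx⟩
      have h1 := hα y
      have h2 : (α y : G) = g * x * g⁻¹ := congrArg Subtype.val hy
      have h3 : g * x * g⁻¹ = g * y * g⁻¹ := h2.symm.trans h1
      have h4 : x = y := by simpa using h3
      exact h4 ▸ y.2
    · exact Subtype.ext (MulEquiv.ext fun x => Subtype.ext (hα x).symm)
  have hsyl := ((isSylowIn_iff (inf_le_inf_right _ hSH)).1 (hS.normalizerIn hP hfn)).map hsurj
  have heq : (fusionSystemOf H S hSH).outBy P hP =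
      ((Fusion.normalizerIn S P).subgroupOf N).map (π.comp ρ) := by
    ext x
    constructor
    · rintro ⟨α, ⟨g, hg, hα⟩, rfl⟩
      exact ⟨⟨g, hSH hg.1, hg.2⟩, hg, congrArg π
        (Subtype.ext (MulEquiv.ext fun x => Subtype.ext (hα x).symm))⟩
    · rintro ⟨g, hg, rfl⟩
      exact ⟨ρ g, ⟨g, hg, hρ g⟩, rfl⟩
  rw [heq]
  exact hsyl

lemma IsSylowIn.receptive [Finite H] (hS : IsSylowIn p S H) {P : Subgroup G} (hP : P ≤ S)
    (hfc : (fusionSystemOf H S hSH).FullyCentralized p P) :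
    (fusionSystemOf H S hSH).Receptive P := by
  intro Q hQ φ hφ
  have hPfin : Finite P := finite_of_le (hP.trans hSH)
  obtain ⟨g, -, hgQ, hQS⟩ := (mem_conjClass_fusionSystemOf hP).1 hQ
  obtain ⟨-, -, h, hh, hφh⟩ := hφ
  have himg : image φ = P := by
    rw [image_eq_conjSubgroup hφh]
    refine Subgroup.eq_of_le_of_card_ge (image_eq_conjSubgroup hφh ▸ image_le φ) ?_
    rw [card_conjSubgroup, hgQ, card_conjSubgroup]
  set C := H ⊓ Subgroup.centralizer (P : Set G) with hC
  set N := Fusion.normalizerIn S P with hN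
  have hNC : ∀ x ∈ N, ∀ y ∈ C, x * y * x⁻¹ ∈ C := by
    intro x hx y hy
    refine ⟨H.mul_mem (H.mul_mem (hSH hx.1) hy.1) (H.inv_mem (hSH hx.1)), ?_⟩
    refine Subgroup.mem_centralizer_iff.2 fun z hz => ?_
    have h1 := Subgroup.mem_centralizer_iff.1 hy.2 (x⁻¹ * z * x)
      ((Subgroup.mem_normalizer_iff.1 hx.2 _).2 (by simpa [mul_assoc] using hz))
    calc z * (x * y * x⁻¹) = x * (x⁻¹ * z * x * y) * x⁻¹ := by group
      _ = x * y * x⁻¹ * z := by rw [h1]; group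
  have hNH : N ≤ H := inf_le_left.trans hSH
  have hLfin : Finite (N ⊔ C : Subgroup G) := finite_of_le (sup_le hNH inf_le_left)
  have hCfin : Finite C := finite_of_le (inf_le_left : _ ≤ H)
  obtain ⟨R, hR, hRs⟩ := exists_isSylowIn_ge (p := p) (le_sup_left : N ≤ N ⊔ C)
    (hS.isPGroup.to_le inf_le_left)
  have hCN : Fusion.centralizerIn S P ≤ N :=
    inf_le_inf_left _ (Subgroup.centralizer_le_normalizer _)
  have hRC : Fusion.centralizerIn S P = R ⊓ C := (hS.centralizerIn hP hfc).eq_of_le inf_le_right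
    (hRs.isPGroup.to_le inf_le_left) (le_inf (hCN.trans hR) (inf_le_inf_right _ hSH))
  -- `N` is Sylow in `N C`: a Sylow subgroup `R ≥ N` meets `C` in `C_S(P) ≤ N`, so `R = N` by the
  -- modular law.
  have hRN : R ≤ N := by
    intro x hx
    obtain ⟨z, hz, c, hc, rfl⟩ := exists_eq_mul_of_mem_sup hNC (hRs.le hx)
    have hcR : c ∈ R := by
      have := R.mul_mem (R.inv_mem (hR hz)) hx
      rwa [inv_mul_cancel_left] at this
    exact N.mul_mem hz (hCN (hRC ▸ ⟨hcR, hc⟩))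
  have hEL : conjSubgroup h (extender S φ) ≤ N ⊔ C := by
    refine conjSubgroup_le.2 ?_
    rintro y ⟨hyN, z, hz, hyz⟩
    rw [himg] at hz
    have hc : z⁻¹ * (h * y * h⁻¹) ∈ C := by
      refine ⟨H.mul_mem (H.inv_mem (hSH hz.1))
        (H.mul_mem (H.mul_mem hh (hSH hyN.1)) (H.inv_mem hh)), ?_⟩
      refine Subgroup.mem_centralizer_iff.2 fun w hw => ?_
      rw [SetLike.mem_coe, ← himg] at hw
      obtain ⟨x, rfl⟩ := hw
      have hyx : y * x * y⁻¹ ∈ Q := (Subgroup.mem_normalizer_iff.1 hyN.2 x).1 x.2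
      have h1 := hyz x ⟨_, hyx⟩ rfl
      rw [hφh, hφh] at h1
      change (φ x : G) * _ = _ * (φ x : G)
      rw [hφh]
      have h2 : h * (y * x * y⁻¹) * h⁻¹ = z * (h * x * h⁻¹) * z⁻¹ := h1
      have h3 : z⁻¹ * (h * (y * x * y⁻¹) * h⁻¹) * z = h * x * h⁻¹ := by rw [h2]; group
      nth_rw 1 [← h3]
      group
    have := (N ⊔ C).mul_mem ((le_sup_left : N ≤ N ⊔ C) hz) ((le_sup_right : C ≤ N ⊔ C) hc)
    rwa [mul_inv_cancel_left] at this
  have hES : extender S φ ≤ S := fun y hy => hy.1.1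
  obtain ⟨l, hl, hlE⟩ := hRs.conj _ hEL (isPGroup_conjSubgroup (hS.isPGroup.to_le hES) h)
  -- The factor `z` lies in `S` and can be dropped. The factor `c` centralizes `P`, so `c h` still
  -- induces `φ`.
  obtain ⟨z, hz, c, hc, rfl⟩ := exists_eq_mul_of_mem_sup hNC hl
  have hk : ∀ y ∈ extender S φ, (c * h) * y * (c * h)⁻¹ ∈ S := by
    intro y hy
    have h1 : (z * c) * (h * y * h⁻¹) * (z * c)⁻¹ ∈ S :=
      (hRN (conjSubgroup_le.1 hlE _ (conj_mem_conjSubgroup hy))).1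
    have h2 := S.mul_mem (S.mul_mem (S.inv_mem hz.1) h1) hz.1
    convert h2 using 1
    group
  refine ⟨conjRestrict (c * h) hk, ⟨hES, le_rfl, c * h, H.mul_mem hc.1 hh, fun x => rfl⟩,
    fun x => ⟨⟨⟨hQS x.2, Subgroup.le_normalizer x.2⟩, φ x, ?_, fun a b hab => ?_⟩, ?_⟩⟩
  · rw [himg]
    exact ⟨hP (φ x).2, Subgroup.le_normalizer (φ x).2⟩
  · rw [hφh, hφh, hφh, hab]
    group
  · change (c * h) * x * (c * h)⁻¹ = φ x
    have h1 := Subgroup.mem_centralizer_iff.1 hc.2 (φ x) (φ x).2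
    rw [conj_mul_conj, ← hφh x, mul_inv_eq_iff_eq_mul, h1]

/-- The fusion system of a finite group over a Sylow `p`-subgroup is saturated. -/
theorem IsSylowIn.isSaturated [Finite H] (hS : IsSylowIn p S H) :
    (fusionSystemOf H S hSH).IsSaturated p where
  sylow_axiom _ hP hfn := ⟨hS.fullyAutomized hP hfn, hS.fullyCentralized hP hfn⟩
  extension_axiom _ hP hfc := hS.receptive hP hfc
  continuity_axiom P hP _ _ h := h P le_rfl (finite_of_le (hP.trans hSH))

end

/-! ### Exhaustions and unions: part (b). -/

section

variable {G : Type*} [Group G] {p : ℕ}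

lemma IsSylowExhaustion.exists_le {S : Subgroup G} {H : ℕ → Subgroup G}
    (hH : IsSylowExhaustion p S H) (R : Subgroup G) [Finite R] : ∃ i, R ≤ H i := by
  have hmem : ∀ x : G, ∃ i, x ∈ H i := fun x =>
    Set.mem_iUnion.1 (hH.iUnion_eq ▸ Set.mem_univ x)
  choose i hi using hmem
  obtain ⟨M, hM⟩ := (Set.finite_range fun x : R => i x).bddAbove
  exact ⟨M, fun x hx => hH.mono (hM ⟨⟨x, hx⟩, rfl⟩) (hi x)⟩

lemma IsSylowExhaustion.eq_iUnion {S : Subgroup G} {H : ℕ → Subgroup G}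
    (hH : IsSylowExhaustion p S H) : (S : Set G) = ⋃ i, ((S ⊓ H i : Subgroup G) : Set G) := by
  simp only [Subgroup.coe_inf, ← Set.inter_iUnion, hH.iUnion_eq, Set.inter_univ]

variable [Fact p.Prime]

/-- A countable locally finite group is exhausted by finite subgroups whose intersections with a
given Sylow `p`-subgroup are Sylow. -/
theorem exists_isSylowExhaustion [Countable G] (hG : IsLocallyFiniteGroup G) {S : Subgroup G}
    (hS : IsSylow p S) : ∃ H : ℕ → Subgroup G, IsSylowExhaustion p S H := by
  obtain ⟨e, he⟩ := exists_surjective_nat G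
  let H : ℕ → Subgroup G := fun i => Subgroup.closure (e '' Set.Iic i)
  have hHmono : Monotone H := fun i j hij =>
    Subgroup.closure_mono (Set.image_mono (Set.Iic_subset_Iic.2 hij))
  have hHfin : ∀ i, Finite (H i) := fun i =>
    hG _ ((Subgroup.fg_iff _).2 ⟨_, rfl, (Set.finite_Iic i).image e⟩)
  obtain ⟨R₀, -, hR₀⟩ := exists_isSylowIn_ge (p := p) (bot_le : ⊥ ≤ H 0) IsPGroup.of_bot
  have hstep : ∀ (i : ℕ) (R : {R // IsSylowIn p R (H i)}),
      ∃ R' : {R // IsSylowIn p R (H (i + 1))}, R.1 ≤ R'.1 := by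
    rintro i ⟨R, hR⟩
    obtain ⟨R', h, hR'⟩ := exists_isSylowIn_ge (p := p) (hR.le.trans (hHmono i.le_succ))
      hR.isPGroup
    exact ⟨⟨R', hR'⟩, h⟩
  choose next hnext using hstep
  let R : ∀ i, {R // IsSylowIn p R (H i)} := fun i => Nat.rec ⟨R₀, hR₀⟩ next i
  have hRmono : Monotone fun i => (R i).1 := monotone_nat_of_le_succ fun i => hnext i (R i)
  have hU : IsPGroup p (⨆ i, (R i).1 : Subgroup G) := by
    rintro ⟨x, hx⟩
    obtain ⟨i, hi⟩ := (Subgroup.mem_iSup_of_directed hRmono.directed_le).1 hx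
    obtain ⟨k, hk⟩ := (R i).2.isPGroup ⟨x, hi⟩
    exact ⟨k, Subtype.ext (by simpa using congrArg Subtype.val hk)⟩
  -- One `g` conjugates all the chosen Sylow subgroups into `S` at once, so the chain `H` is
  -- replaced by its conjugate under `g`.
  obtain ⟨g, hg⟩ := hS.exists_conjSubgroup_le hU
  refine ⟨fun i => conjSubgroup g (H i), fun i => inferInstance,
    fun i j hij => conjSubgroup_mono (hHmono hij), Set.eq_univ_of_forall fun x => ?_,
    fun i => (isSylowIn_iff inf_le_right).1 ⟨inf_le_right, hS.1.to_le inf_le_left,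
      fun A hA hAp => ?_⟩⟩
  · obtain ⟨k, hk⟩ := he (g⁻¹ * x * g)
    refine Set.mem_iUnion.2 ⟨k, e k, Subgroup.subset_closure ⟨k, Set.mem_Iic.2 le_rfl, rfl⟩, ?_⟩
    change g * e k * g⁻¹ = x
    rw [hk]
    group
  · have hA' : conjSubgroup g⁻¹ A ≤ H i := by
      have := conjSubgroup_mono (g := g⁻¹) hA
      rwa [conjSubgroup_inv_conjSubgroup] at this
    obtain ⟨h, hh, hhA⟩ := (R i).2.conj _ hA' (isPGroup_conjSubgroup hAp _)
    have h1 := conjSubgroup_mono (g := g) hhA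
    rw [conjSubgroup_conjSubgroup, conjSubgroup_conjSubgroup] at h1
    exact ⟨g * h * g⁻¹, conj_mem_conjSubgroup hh, h1.trans (le_inf
      ((conjSubgroup_mono (le_iSup (fun i => (R i).1) i)).trans hg)
      (conjSubgroup_mono (R i).2.le))⟩

/-- The fusion system of `G` is the union of the fusion systems of an exhaustion. -/
theorem IsSylowExhaustion.isUnion (hG : IsLocallyFiniteGroup G) {S : Subgroup G}
    (hsat : (fusionSystemOf ⊤ S le_top).IsSaturated p) {H : ℕ → Subgroup G}
    (hH : IsSylowExhaustion p S H) :
    (fusionSystemOf ⊤ S le_top).IsUnion p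
      (fun i => fusionSystemOf (H i) (S ⊓ H i) inf_le_right) where
  finite i := have := hH.finite i; finite_of_le inf_le_right
  mono i j hij := inf_le_inf_left _ (hH.mono hij)
  iUnion_eq := hH.eq_iUnion.symm
  hom_mono i j hij P Q hP hQ := by
    rintro φ ⟨-, -, g, hg, h⟩
    have hle := inf_le_inf_left S (hH.mono hij)
    exact ⟨hP.trans hle, hQ.trans hle, g, hH.mono hij hg, h⟩
  saturated i :=
    have := hH.finite i
    IsSylowIn.isSaturated ((isSylowIn_iff inf_le_right).2 (hH.sylow i))
  hom_eq P Q hP hQ := by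
    ext φ
    constructor
    · rintro ⟨-, -, g, -, hg⟩ R hR hRfin
      obtain ⟨i, hi⟩ := hH.exists_le R
      obtain ⟨j, hj⟩ := Set.mem_iUnion.1 (hH.iUnion_eq ▸ Set.mem_univ g)
      have hRk := hi.trans (hH.mono (le_max_left i j))
      have hgk := hH.mono (le_max_right i j) hj
      have hmap : ∀ x ∈ R, g * x * g⁻¹ ∈ Q ⊓ (S ⊓ H (max i j)) := fun x hx => by
        have h1 := (φ ⟨x, hR hx⟩).2
        rw [hg] at h1
        exact ⟨h1, hQ h1, (H _).mul_mem ((H _).mul_mem hgk (hRk hx)) ((H _).inv_mem hgk)⟩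
      have hRS : R ≤ S ⊓ H (max i j) := le_inf (hR.trans hP) hRk
      exact ⟨max i j, hRS, conjRestrict g hmap, ⟨hRS, inf_le_right, g, hgk, fun _ => rfl⟩,
        fun x => (hg (Subgroup.inclusion hR x)).symm⟩
    · intro hφ
      have hloc : ∀ (R : Subgroup G) (hR : R ≤ P), Finite R →
          ∃ g, ∀ x : R, (φ (Subgroup.inclusion hR x) : G) = g * x * g⁻¹ := by
        intro R hR hRfin
        obtain ⟨i, -, ψ, ⟨-, -, g, -, hg⟩, hψ⟩ := hφ R hR hRfin
        exact ⟨g, fun x => (hψ x).symm.trans (hg x)⟩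
      -- Injectivity is tested on cyclic subgroups, which are finite by local finiteness.
      have hinj : Function.Injective φ := by
        rw [injective_iff_map_eq_one]
        intro x hx
        obtain ⟨g, hg⟩ := hloc (Subgroup.zpowers (x : G)) (Subgroup.zpowers_le.2 x.2)
          (hG _ ((Subgroup.fg_iff _).2 ⟨{(x : G)}, (Subgroup.zpowers_eq_closure _).symm,
            Set.finite_singleton _⟩))
        have h1 := hg ⟨x, Subgroup.mem_zpowers _⟩
        have h2 : (φ x : G) = g * x * g⁻¹ := h1
        rw [hx, Subgroup.coe_one, eq_comm] at h2
        exact Subtype.ext (by simpa using h2)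
      obtain ⟨-, -, g, hg, h⟩ := hsat.continuity_axiom P hP ((Subgroup.inclusion hQ).comp φ)
        ((Subgroup.inclusion_injective hQ).comp hinj) (fun R hR hRfin => by
          obtain ⟨g, hg⟩ := hloc R hR hRfin
          exact ⟨hR.trans hP, le_rfl, g, trivial, hg⟩)
      exact ⟨hP, hQ, g, hg, h⟩

end

end Fusion

theorem propositionp (p : ℕ) [Fact p.Prime] {G : Type*} [Group G]
    (hG : Fusion.IsLocallyFiniteGroup G) (S : Subgroup G) (hS : Fusion.IsDiscreteToral p S)
    (F : Fusion.FusionSystem S) (hF : F.IsSaturated p)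
    (hFG : F = Fusion.fusionSystemOf ⊤ S le_top) :
    (∃ K : Subgroup G, Countable K ∧ ∃ hSK : S ≤ K, F = Fusion.fusionSystemOf K S hSK) ∧
    (Countable G → Fusion.IsSylow p S →
      (∃ H : ℕ → Subgroup G, Fusion.IsSylowExhaustion p S H) ∧
      ∀ H : ℕ → Subgroup G, Fusion.IsSylowExhaustion p S H →
        (S : Set G) = ⋃ i, ((S ⊓ H i : Subgroup G) : Set G) ∧
        F.IsUnion p (fun i => Fusion.fusionSystemOf (H i) (S ⊓ H i) inf_le_right)) := by
  subst hFG
  obtain ⟨hScount, T, m, hT⟩ := hS.exists_isTorusIn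
  exact ⟨hT.exists_countable hG hScount hF, fun _ hSyl =>
    ⟨Fusion.exists_isSylowExhaustion hG hSyl, fun H hH => ⟨hH.eq_iUnion, hH.isUnion hG hF⟩⟩⟩
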